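/- Let $(X,W,Y)$ be a random triple, $\hat Y=f(X,W)$ for a fixed measurable prediction function $f$, and let $(X_i,W_i,Y_i)_{i\ge1}$ be i.i.d. copies of $(X,W,Y)$, $\hat Y_i=f(X_i,W_i)$, where $Y_i$ is used only for $i\le n$ ($n$ labeled and $N$ unlabeled observations). Let $\Theta\subseteq\mathbb R^d$, let $\ell_\theta(x,y)$ be a loss, and assume that $\theta^\star=\arg\min_{\theta\in\Theta}\mathbb E[\ell_\theta(X,Y)]$ is the unique minimizer and lies in the interior of $\Theta$. For an imputed loss $g_\theta(x,\hat y)$ let $\hat\theta_g$ be a (measurable) minimizer over $\Theta$ of $$\mathcal L_g(\theta)=\frac1n\sum_{i=1}^n\ell_\theta(X_i,Y_i)-\Big(\frac1n\sum_{i=1}^n g_\theta(X_i,\hat Y_i)-\frac1N\sum_{i=n+1}^{n+N}g_\theta(X_i,\hat Y_i)\Big)$$ whenever a minimizer exists (and an arbitrary value otherwise). Let $n\to\infty$ and $n/N\to r\in[0,\infty)$. Say that a loss $m_\theta(S)$, $S$ a random variable, is *regular* if $m_\theta(S)$ is integrable for every $\theta\in\Theta$ and: (i) almost surely $\theta\mapsto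 m_\theta(S)$ is convex on $\Theta$ and differentiable at $\theta^\star$; (ii) there are a neighborhood of $\theta^\star$ and a function $M$ with $\mathbb E[M(S)^2]<\infty$ such that almost surely $\theta\mapsto m_\theta(S)$ is $M(S)$-Lipschitz on this neighborhood; (iii) $\theta\mapsto\mathbb E[m_\theta(S)]$ is twice differentiable at $\theta^\star$ with positive definite Hessian; (iv) $\mathrm{Cov}(\nabla m_{\theta^\star}(S))$ is positive definite. Assume that $\ell_\theta(X,Y)$ is regular, and let $H$ be the Hessian of $\theta\mapsto\mathbb E[\ell_\theta(X,Y)]$ at $\theta^\star$. For every $g$ whose gradient $\nabla g_{\theta^\star}(X,\hat Y)$ exists almost surely and is square integrable put $$\Sigma_g=H^{-1}\big(r\,\mathrm{Cov}(\nabla g_{\theta^\star}(X,\hat Y))+\mathrm{Cov}(\nabla\ell_{\theta^\star}(X,Y)-\nabla g_{\theta^\star}(X,\hat Y))\big)H^{-1}.$$ 1. If $g_\theta(X,\hat Y)$ is regular and $\mathcal L_g$ is almost surely convex on $\Theta$ (for all sample sizes $n,N$ along the sequence), then $\Sigma_g$ is positive semidefinite and $\sqrt n(\hat\theta_g-\theta^\star)\to\mathcal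 N(0,\Sigma_g)$ in distribution. 2. If $g$ has an almost surely existing, square-integrable gradient at $\theta^\star$ and $\nabla g_{\theta^\star}(X,\hat Y)=\frac1{1+r}\mathbb E[\nabla\ell_{\theta^\star}(X,Y)\mid X,\hat Y]$ almost surely, then $$\Sigma_g=H^{-1}\Big(\mathrm{Cov}(\nabla\ell_{\theta^\star}(X,Y))-\frac1{1+r}\mathrm{Cov}\big(\mathbb E[\nabla\ell_{\theta^\star}(X,Y)\mid X,\hat Y]\big)\Big)H^{-1},$$ and $\Sigma_g\preceq\Sigma_{g'}$ in the Loewner order for every imputed loss $g'$ whose gradient at $\theta^\star$ exists almost surely and is square integrable. -/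

import Mathlib

open MeasureTheory ProbabilityTheory Filter Topology
open scoped ENNReal Matrix

noncomputable section

namespace PPI

/-- The set of minimizers of `F` over `Θ`. -/
def argminOn {E : Type*} (Θ : Set E) (F : E → ℝ) : Set E :=
  {θ | θ ∈ Θ ∧ IsMinOn F Θ θ}

/-- The Hessian matrix of `F` at `θ` (entries are second partial derivatives of `F`). -/
def hessianMatrix {d : ℕ} (F : EuclideanSpace ℝ (Fin d) → ℝ) (θ : EuclideanSpace ℝ (Fin d)) :
    Matrix (Fin d) (Fin d) ℝ :=
  Matrix.of fun i j =>
    fderiv ℝ (fderiv ℝ F) θ (EuclideanSpace.single i 1) (EuclideanSpace.single j 1)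

/-- `F` is twice differentiable at `θ`: differentiable near `θ`, with derivative differentiable
at `θ`. -/
def TwiceDifferentiableAt {d : ℕ} (F : EuclideanSpace ℝ (Fin d) → ℝ)
    (θ : EuclideanSpace ℝ (Fin d)) : Prop :=
  (∀ᶠ t in 𝓝 θ, DifferentiableAt ℝ F t) ∧ DifferentiableAt ℝ (fderiv ℝ F) θ

/-- The covariance matrix of a random vector `V` under `μ`. -/
def covMatrix {d : ℕ} {S : Type*} [MeasurableSpace S] (V : S → EuclideanSpace ℝ (Fin d))
    (μ : Measure S) : Matrix (Fin d) (Fin d) ℝ :=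
  Matrix.of fun i j => covariance (fun s => V s i) (fun s => V s j) μ

/-- The gradient in the parameter `∇ m_θ(s)` of a parametrized loss `m`. -/
def lossGradient {d : ℕ} {S : Type*} (m : EuclideanSpace ℝ (Fin d) → S → ℝ)
    (θ : EuclideanSpace ℝ (Fin d)) (s : S) : EuclideanSpace ℝ (Fin d) :=
  gradient (fun t => m t s) θ

/-- The population loss `θ ↦ E[m_θ(S)]` when `S` has law `μ`. -/
def populationLoss {d : ℕ} {S : Type*} [MeasurableSpace S]
    (m : EuclideanSpace ℝ (Fin d) → S → ℝ) (μ : Measure S) (θ : EuclideanSpace ℝ (Fin d)) : ℝ :=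
  ∫ s, m θ s ∂μ

/-- The regularity conditions at `θ₀` on a parametrized loss `m` evaluated at a random point
with law `μ`, the parameter space being `Θ`. -/
structure RegularLoss {d : ℕ} {S : Type*} [MeasurableSpace S]
    (Θ : Set (EuclideanSpace ℝ (Fin d))) (m : EuclideanSpace ℝ (Fin d) → S → ℝ)
    (θ₀ : EuclideanSpace ℝ (Fin d)) (μ : Measure S) : Prop where
  /-- the population loss is well defined -/
  integrable : ∀ θ ∈ Θ, Integrable (m θ) μ
  /-- almost surely convex in the parameter -/
  convex : ∀ᵐ s ∂μ, ConvexOn ℝ Θ (fun θ => m θ s)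
  /-- almost surely differentiable at `θ₀` -/
  differentiable : ∀ᵐ s ∂μ, DifferentiableAt ℝ (fun θ => m θ s) θ₀
  /-- locally Lipschitz around `θ₀`, with a square-integrable random Lipschitz constant -/
  lipschitz : ∃ U ∈ 𝓝 θ₀, ∃ M : S → ℝ, MemLp M 2 μ ∧
    ∀ᵐ s ∂μ, ∀ θ ∈ U, ∀ θ' ∈ U, |m θ s - m θ' s| ≤ M s * ‖θ - θ'‖
  /-- the population loss has a Hessian at `θ₀` -/
  twice_differentiable : TwiceDifferentiableAt (populationLoss m μ) θ₀
  /-- which is positive definite -/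
  hessian_posDef : (hessianMatrix (populationLoss m μ) θ₀).PosDef
  /-- the gradient at `θ₀` has positive definite covariance matrix -/
  cov_posDef : (covMatrix (lossGradient m θ₀) μ).PosDef

/-- `m` is almost surely differentiable at `θ₀`, with a square-integrable gradient there. -/
def HasSquareIntegrableGradient {d : ℕ} {S : Type*} [MeasurableSpace S]
    (m : EuclideanSpace ℝ (Fin d) → S → ℝ) (θ₀ : EuclideanSpace ℝ (Fin d)) (μ : Measure S) :
    Prop :=
  (∀ᵐ s ∂μ, DifferentiableAt ℝ (fun θ => m θ s) θ₀) ∧ MemLp (lossGradient m θ₀) 2 μ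

/-- From an observation `(x, w, y)` to the pair `(x, y)` that enters the loss. -/
def toXY {𝒳 𝒲 𝒴 : Type*} (z : 𝒳 × 𝒲 × 𝒴) : 𝒳 × 𝒴 := (z.1, z.2.2)

/-- From an observation `(x, w, y)` to the pair `(x, ŷ)`, where `ŷ = f x w` is the prediction. -/
def toXYhat {𝒳 𝒲 𝒴 𝒵 : Type*} (f : 𝒳 → 𝒲 → 𝒵) (z : 𝒳 × 𝒲 × 𝒴) : 𝒳 × 𝒵 :=
  (z.1, f z.1 z.2.1)

/-- The PPI objective with imputed loss `g`, from the labeled observations with index `i < n` and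
the unlabeled observations with index `n ≤ i < n + N`. -/
def ppiObjective {d : ℕ} {𝒳 𝒲 𝒴 𝒵 : Type*} (ℓ : EuclideanSpace ℝ (Fin d) → 𝒳 × 𝒴 → ℝ)
    (g : EuclideanSpace ℝ (Fin d) → 𝒳 × 𝒵 → ℝ) (f : 𝒳 → 𝒲 → 𝒵) (n N : ℕ)
    (x : ℕ → 𝒳) (w : ℕ → 𝒲) (y : ℕ → 𝒴) (θ : EuclideanSpace ℝ (Fin d)) : ℝ :=
  (1 / (n : ℝ)) * ∑ i ∈ Finset.range n, ℓ θ (x i, y i)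
    - ((1 / (n : ℝ)) * ∑ i ∈ Finset.range n, g θ (x i, f (x i) (w i))
      - (1 / (N : ℝ)) * ∑ i ∈ Finset.Ico n (n + N), g θ (x i, f (x i) (w i)))

section Asymptotics

variable {d : ℕ} {𝒳 𝒲 𝒴 𝒵 : Type*}
  [MeasurableSpace 𝒳] [MeasurableSpace 𝒲] [MeasurableSpace 𝒴] [MeasurableSpace 𝒵]

/-- `s★(X, Ŷ) = E[∇ℓ_θ(X, Y) | X, Ŷ]`, as a function of `(X, W, Y)`, which has law `Q`. -/
def condGradient (ℓ : EuclideanSpace ℝ (Fin d) → 𝒳 × 𝒴 → ℝ) (f : 𝒳 → 𝒲 → 𝒵)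
    (Q : Measure (𝒳 × 𝒲 × 𝒴)) (θ : EuclideanSpace ℝ (Fin d)) :
    𝒳 × 𝒲 × 𝒴 → EuclideanSpace ℝ (Fin d) :=
  condExp (MeasurableSpace.comap (toXYhat f) inferInstance) Q
    (fun z => lossGradient ℓ θ (toXY z))

/-- `H_θ`, the Hessian at `θ` of the population loss `θ ↦ E[ℓ_θ(X, Y)]`. -/
def lossHessian (ℓ : EuclideanSpace ℝ (Fin d) → 𝒳 × 𝒴 → ℝ) (Q : Measure (𝒳 × 𝒲 × 𝒴))
    (θ : EuclideanSpace ℝ (Fin d)) : Matrix (Fin d) (Fin d) ℝ :=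
  hessianMatrix (populationLoss ℓ (Q.map toXY)) θ

/-- The asymptotic covariance
`Σ_g = H⁻¹ (r Cov(∇g_θ(X, Ŷ)) + Cov(∇ℓ_θ(X, Y) - ∇g_θ(X, Ŷ))) H⁻¹`. -/
def asymCov (ℓ : EuclideanSpace ℝ (Fin d) → 𝒳 × 𝒴 → ℝ)
    (g : EuclideanSpace ℝ (Fin d) → 𝒳 × 𝒵 → ℝ) (f : 𝒳 → 𝒲 → 𝒵)
    (Q : Measure (𝒳 × 𝒲 × 𝒴)) (r : ℝ) (θ : EuclideanSpace ℝ (Fin d)) :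
    Matrix (Fin d) (Fin d) ℝ :=
  (lossHessian ℓ Q θ)⁻¹ *
    (r • covMatrix (fun z => lossGradient g θ (toXYhat f z)) Q
      + covMatrix (fun z => lossGradient ℓ θ (toXY z) - lossGradient g θ (toXYhat f z)) Q) *
    (lossHessian ℓ Q θ)⁻¹

end Asymptotics

end PPI

end

/-! ### Convex functions and second-order expansion in finite dimension. -/

section Deterministic

/-! Asymptotic normality is the convexity argument of Hjort and Pollard. In the local parameter `h =
√n (θ - θstar)`, `n` times the increment of the objective is `⟨h, S⟩ + ⟨h, H h⟩ / 2 + o_P(1)` for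
each fixed `h`, where `S` is the centered `scoreSum`. Indeed, after removal of `⟨h, S⟩` there remain
a centered sum of first-order remainders, which tend to zero in `L²` and are killed by Chebyshev,
and `n` times the increment of the population loss, which has a Taylor limit at the critical point
`θstar`; the mean increments of `g` cancel between the two samples. As the score is centered from
the start, derivative and expectation never have to be interchanged.

Convexity turns closeness at finitely many `h` into uniform closeness on a ball
(`exists_finset_forall_convexOn_abs_sub_le`). Hence, with probability tending to one, minimizers
exist and all lie near the minimizer `-H⁻¹ S` of the quadratic
(`tendstoInMeasure_argmin_of_convexOn`); no separate consistency proof is needed, and the arbitrary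
value of the estimator elsewhere is harmless. The limit of `-H⁻¹ S` comes from characteristic
functions (`tendsto_charFun_scoreSum`): the labeled sample contributes `Cov(∇ℓ - ∇g)`, the unlabeled
one `r Cov(∇g)`. Slutsky concludes.

Optimality is a projection argument. With `u = ∇ℓ`, `v = ∇g` and `s = E[u | X, Ŷ]`, the covariance
of `u` with a function of `(X, Ŷ)` is that of `s`, so completing the square gives `r Cov v + Cov(u -
v) = Cov u - Cov s / (1 + r) + (1 + r) Cov(v - s / (1 + r))`. Only the last term depends on `g`; it
is positive semidefinite and vanishes at `v = s / (1 + r)`. Conjugation by the symmetric `H⁻¹`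
preserves the Loewner order. -/

/-- A convex function that is close to a continuous function on a suitable finite set is uniformly
close to it on a ball. -/
theorem exists_finset_forall_convexOn_abs_sub_le {E : Type*} [NormedAddCommGroup E]
    [NormedSpace ℝ E] [FiniteDimensional ℝ E] {q : E → ℝ} (hq : Continuous q) (R : ℝ)
    {η : ℝ} (hη : 0 < η) :
    ∃ F : Finset E, ∃ δ > 0, ∃ R' : ℝ, ∀ φ : E → ℝ, ConvexOn ℝ (Metric.closedBall 0 R') φ →
      (∀ p ∈ F, |φ p - q p| ≤ δ) → ∀ x ∈ Metric.closedBall (0 : E) R, |φ x - q x| ≤ η := by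
  classical
  obtain ⟨T, hT₁, hT₂⟩ :=
    (convex_closedBall (0 : E) (R + 2)).exists_subset_interior_convexHull_finset_of_isCompact
    (isCompact_closedBall (0 : E) (R + 2)) (t := Metric.closedBall 0 (R + 3))
    (by
      rw [mem_nhdsSet_iff_forall]
      intro x hx
      rw [mem_closedBall_zero_iff] at hx
      refine Filter.mem_of_superset (Metric.closedBall_mem_nhds x one_pos) ?_
      intro y hy
      rw [mem_closedBall_iff_norm] at hy
      rw [mem_closedBall_zero_iff]
      have := norm_add_le (y - x) x
      rw [sub_add_cancel] at this
      linarith)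
  obtain ⟨B, hB⟩ : ∃ B : ℝ, ∀ p ∈ T, q p ≤ B := by
    obtain ⟨B, hB⟩ := (T.image q).bddAbove
    exact ⟨B, fun p hp => hB (Finset.mem_coe.2 (Finset.mem_image_of_mem q hp))⟩
  -- `M` will bound `|φ|` on the ball of radius `R + 2`: from above by the values at the vertices
  -- `T`, from below by `φ y ≥ 2 φ 0 - φ (-y)`. A convex function bounded by `M` is `2 M`-Lipschitz
  -- on the ball of radius smaller by one, whence `L`.
  set M : ℝ := |B| + 1 + 2 * (|q 0| + 1) with hM
  have hMpos : 0 < M := by positivity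
  set L : ℝ := 2 * M with hL
  obtain ⟨r₁, hr₁, huc⟩ := Metric.uniformContinuousOn_iff.1
    ((isCompact_closedBall (0 : E) R).uniformContinuousOn_of_continuous hq.continuousOn)
    (η / 3) (by positivity)
  set r : ℝ := min r₁ (η / (3 * L)) with hr
  have hrpos : 0 < r := by positivity
  obtain ⟨N, hN₁, hN₂⟩ := (isCompact_closedBall (0 : E) R).elim_finite_subcover_image
    (b := Metric.closedBall 0 R) (c := fun x => Metric.ball x r) (fun _ _ => Metric.isOpen_ball)
    (fun x hx => Set.mem_iUnion₂_of_mem hx (Metric.mem_ball_self hrpos))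
  obtain ⟨hNf, hN₂⟩ := hN₂
  -- The origin and `T` control the Lipschitz constant of `φ`; the `r`-net `N` carries the
  -- approximation. With `p` a net point near `x`, each of `φ x - φ p`, `φ p - q p` and `q x - q p`
  -- costs `η / 3`.
  refine ⟨insert 0 (T ∪ hNf.toFinset), min 1 (η / 3), by positivity, R + 3, ?_⟩
  intro φ hφ hclose x hx
  have hupper : ∀ y ∈ Metric.closedBall (0 : E) (R + 2), φ y ≤ |B| + 1 := by
    intro y hy
    obtain ⟨p, hp, hyp⟩ := hφ.exists_ge_of_mem_convexHull
      ((subset_convexHull ℝ _).trans hT₂) (interior_subset (hT₁ hy))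
    have h1 := (abs_le.1 (hclose p (by simp [Finset.mem_coe.1 hp]))).2
    have h2 := hB p hp
    have h3 := le_abs_self B
    have h4 := min_le_left (1 : ℝ) (η / 3)
    linarith
  have h0 : |φ 0 - q 0| ≤ 1 := (hclose 0 (by simp)).trans (min_le_left _ _)
  have hbound : ∀ y, dist y 0 < R + 2 → |φ y| ≤ M := by
    intro y hy
    have hy' : y ∈ Metric.closedBall (0 : E) (R + 2) := Metric.mem_closedBall.2 hy.le
    have hyn : -y ∈ Metric.closedBall (0 : E) (R + 2) := by simpa using hy'
    have h3 : Metric.closedBall (0 : E) (R + 2) ⊆ Metric.closedBall 0 (R + 3) :=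
      Metric.closedBall_subset_closedBall (by linarith)
    have hc := hφ.2 (h3 hy') (h3 hyn) (by norm_num : (0 : ℝ) ≤ 1 / 2)
      (by norm_num : (0 : ℝ) ≤ 1 / 2) (by norm_num)
    simp only [smul_neg, add_neg_cancel, smul_eq_mul] at hc
    have h4 := hupper y hy'
    have h5 := hupper _ hyn
    have h6 := (abs_le.1 h0).1
    have h7 := neg_abs_le (q 0)
    have h8 := abs_nonneg (q 0)
    rw [abs_le]
    constructor <;> linarith
  have hlip := (hφ.subset (s := Metric.ball (0 : E) (R + 2)) (fun y hy =>
    Metric.closedBall_subset_closedBall (by linarith) (Metric.ball_subset_closedBall hy))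
    (convex_ball _ _)).lipschitzOnWith_of_abs_le one_pos hbound
  obtain ⟨p, hp, hxp⟩ := Set.mem_iUnion₂.1 (hN₂ hx)
  have hpR := hN₁ hp
  have hsub : Metric.closedBall (0 : E) R ⊆ Metric.ball 0 (R + 2 - 1) :=
    Metric.closedBall_subset_ball (by linarith)
  have h1 := hlip.dist_le_mul x (hsub hx) p (hsub hpR)
  rw [Real.dist_eq, Real.coe_toNNReal _ (by positivity), div_one] at h1
  have hxp' : dist x p < r := hxp
  have h2 : L * dist x p ≤ η / 3 := by
    calc L * dist x p ≤ L * (η / (3 * L)) := by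
          gcongr
          exact hxp'.le.trans (min_le_right _ _)
      _ = η / 3 := by
          have : L ≠ 0 := by positivity
          field_simp
  have h3 := huc x hx p hpR (hxp'.trans_le (min_le_left _ _))
  rw [Real.dist_eq] at h3
  have h4 := (hclose p (by simp [hp])).trans (min_le_right _ _)
  have h5 : φ x - q x = (φ x - φ p) + (φ p - q p) - (q x - q p) := by ring
  rw [h5]
  have h6 := abs_sub ((φ x - φ p) + (φ p - q p)) (q x - q p)
  have h7 := abs_add_le (φ x - φ p) (φ p - q p)
  linarith

/-- If a convex function is larger on a sphere than at its center, then it has minimizers, and all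
of them lie in the ball. -/
theorem ConvexOn.exists_isMinOn_of_lt_sphere {E : Type*} [NormedAddCommGroup E]
    [NormedSpace ℝ E] [FiniteDimensional ℝ E] {C : Set E} {G : E → ℝ} (hG : ConvexOn ℝ C G)
    {u : E} {ε : ℝ} (hε : 0 < ε) (hC : Metric.closedBall u ε ⊆ interior C)
    (hlt : ∀ x ∈ Metric.sphere u ε, G u < G x) :
    (∃ x ∈ C, IsMinOn G C x) ∧ ∀ x ∈ C, IsMinOn G C x → ‖x - u‖ < ε := by
  have huC : u ∈ C := interior_subset (hC (Metric.mem_closedBall_self hε.le))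
  constructor
  · obtain ⟨x, hx, hmin⟩ := (isCompact_closedBall u ε).exists_isMinOn
      ⟨u, Metric.mem_closedBall_self hε.le⟩ (hG.continuousOn_interior.mono hC)
    refine ⟨x, interior_subset (hC hx), ?_⟩
    refine IsMinOn.of_isLocalMinOn_of_convexOn (interior_subset (hC hx)) ?_ hG
    have hxb : x ∈ Metric.ball u ε := by
      rcases (Metric.mem_closedBall.1 hx).lt_or_eq with h | h
      · exact h
      · exact absurd (hmin (Metric.mem_closedBall_self hε.le)) (not_le.2 (hlt x h))
    refine Filter.Eventually.filter_mono nhdsWithin_le_nhds ?_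
    filter_upwards [Metric.isOpen_ball.mem_nhds hxb] with y hy
    exact hmin (Metric.ball_subset_closedBall hy)
  · intro x hx hmin
    by_contra! hge
    have hpos : 0 < ‖x - u‖ := hε.trans_le hge
    -- The segment from `u` to a minimizer outside the ball crosses the sphere at parameter `t`,
    -- where convexity forces a value at most `G u`.
    set t : ℝ := ε / ‖x - u‖ with ht
    have ht0 : 0 < t := by positivity
    have ht1 : t ≤ 1 := (div_le_one hpos).2 hge
    have hs : (1 - t) • u + t • x ∈ Metric.sphere u ε := by
      rw [mem_sphere_iff_norm]
      have : (1 - t) • u + t • x - u = t • (x - u) := by module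
      rw [this, norm_smul, Real.norm_of_nonneg ht0.le, ht]
      field_simp
    have h1 := hlt _ hs
    have h2 := hG.2 huC hx (sub_nonneg.2 ht1) ht0.le (by ring)
    have h3 : G x ≤ G u := hmin huC
    simp only [smul_eq_mul] at h2
    nlinarith

/-- Second order expansion at a critical point. -/
theorem PPI.TwiceDifferentiableAt.tendsto_taylor {d : ℕ} {F : EuclideanSpace ℝ (Fin d) → ℝ}
    {θ : EuclideanSpace ℝ (Fin d)} (hF : PPI.TwiceDifferentiableAt F θ) (h0 : fderiv ℝ F θ = 0)
    (h : EuclideanSpace ℝ (Fin d)) {ι : Type*} {l : Filter ι} {s : ι → ℝ}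
    (hs : Tendsto s l atTop) :
    Tendsto (fun k => s k ^ 2 * (F (θ + (s k)⁻¹ • h) - F θ)) l
      (𝓝 (fderiv ℝ (fderiv ℝ F) θ h h / 2)) := by
  obtain ⟨hd, hd2⟩ := hF
  set B := fderiv ℝ (fderiv ℝ F) θ with hB
  obtain ⟨ρ, hρ, hball⟩ := Metric.eventually_nhds_iff_ball.1 hd
  have hsub : Metric.ball (0 : ℝ) (ρ / (‖h‖ + 1)) ∈ 𝓝 (0 : ℝ) := Metric.ball_mem_nhds _ (by positivity)
  -- The second derivative exists only at `θ`, so the expansion is done for the derivative along the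
  -- line, with error `o(t)`, and then integrated to an error `o(t²)`.
  have hlittle : (fun t : ℝ => fderiv ℝ F (θ + t • h) h - t * B h h) =o[𝓝 0]
      fun t : ℝ => (t - 0) ^ 1 := by
    have h1 : HasDerivAt (fun t : ℝ => fderiv ℝ F (θ + t • h) h) (B h h) 0 := by
      have hl : HasDerivAt (fun t : ℝ => θ + t • h) h 0 := by
        simpa using ((hasDerivAt_id (0 : ℝ)).smul_const h).const_add θ
      have h2 : HasFDerivAt (fderiv ℝ F) B (θ + (0 : ℝ) • h) := by
        simpa using hd2.hasFDerivAt
      have h3 := h2.comp_hasDerivAt (0 : ℝ) hl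
      exact (ContinuousLinearMap.apply ℝ ℝ h).hasFDerivAt.comp_hasDerivAt (0 : ℝ) h3
    have h4 := hasDerivAt_iff_isLittleO.1 h1
    simpa [h0] using h4
  have key := (convex_ball (0 : ℝ) (ρ / (‖h‖ + 1))).isLittleO_pow_succ_real
    (f := fun t : ℝ => F (θ + t • h) - t ^ 2 / 2 * B h h)
    (f' := fun t : ℝ => fderiv ℝ F (θ + t • h) h - t * B h h) (n := 1) (x₀ := 0)
    (Metric.mem_ball_self (by positivity)) ?_ (hlittle.mono nhdsWithin_le_nhds)
  · rw [nhdsWithin_eq_nhds.2 hsub] at key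
    have hinv : Tendsto (fun k => (s k)⁻¹) l (𝓝 0) := tendsto_inv_atTop_zero.comp hs
    have := (key.comp_tendsto hinv).tendsto_div_nhds_zero
    rw [← tendsto_sub_nhds_zero_iff]
    refine this.congr' ?_
    filter_upwards [hs.eventually_gt_atTop 0] with k hk
    simp only [Function.comp_apply, zero_smul, add_zero, sub_zero, one_add_one_eq_two]
    generalize F (θ + (s k)⁻¹ • h) = y
    generalize s k = t at hk
    field_simp
    ring
  · intro t ht
    rw [mem_ball_zero_iff] at ht
    have hmem : θ + t • h ∈ Metric.ball θ ρ := by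
      rw [mem_ball_iff_norm, add_sub_cancel_left, norm_smul]
      calc ‖t‖ * ‖h‖ ≤ ‖t‖ * (‖h‖ + 1) := by gcongr; linarith
        _ < ρ / (‖h‖ + 1) * (‖h‖ + 1) := by gcongr
        _ = ρ := by field_simp
    have hl : HasDerivAt (fun t : ℝ => θ + t • h) h t := by
      simpa using ((hasDerivAt_id t).smul_const h).const_add θ
    have h1 := (hball _ hmem).hasFDerivAt.comp_hasDerivAt t hl
    have h2 : HasDerivAt (fun t : ℝ => t ^ 2 / 2 * B h h) (t * B h h) t := by
      have := (((hasDerivAt_id t).pow 2).div_const 2).mul_const (B h h)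
      refine this.congr_deriv ?_
      simp
    exact (h1.sub h2).hasDerivWithinAt

theorem PPI.fderiv_fderiv_eq_dotProduct {d : ℕ} (F : EuclideanSpace ℝ (Fin d) → ℝ)
    (θ h : EuclideanSpace ℝ (Fin d)) :
    fderiv ℝ (fderiv ℝ F) θ h h = h.ofLp ⬝ᵥ (PPI.hessianMatrix F θ *ᵥ h.ofLp) := by
  have hh : h = ∑ i, h i • EuclideanSpace.single i (1 : ℝ) := by
    simpa using ((EuclideanSpace.basisFun (Fin d) ℝ).sum_repr h).symm
  conv_lhs => rw [hh]
  simp only [map_sum, map_smul, sum_apply, smul_apply,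
    smul_eq_mul, dotProduct, Matrix.mulVec, PPI.hessianMatrix, Matrix.of_apply, Finset.mul_sum]
  rw [Finset.sum_comm]
  refine Finset.sum_congr rfl fun i _ => Finset.sum_congr rfl fun j _ => by ring

end Deterministic

/-! ### A central limit theorem for two independent samples. -/

section TwoSample

/-- Take logarithms: `m log (1 + g) = m g + m o(g)`, and `m g` stays bounded while `g → 0`. -/
theorem Complex.tendsto_one_add_pow_exp {ι : Type*} {l : Filter ι} {g : ι → ℂ} {m : ι → ℕ} {t : ℂ}
    (hm : Tendsto m l atTop) (hg : Tendsto (fun k => (m k : ℂ) * g k) l (𝓝 t)) :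
    Tendsto (fun k => (1 + g k) ^ m k) l (𝓝 (Complex.exp t)) := by
  have hm' : Tendsto (fun k => ((m k : ℂ))⁻¹) l (𝓝 0) := by
    have h1 : Tendsto (fun k => ((m k : ℝ))⁻¹) l (𝓝 0) :=
      tendsto_inv_atTop_zero.comp (tendsto_natCast_atTop_atTop.comp hm)
    have h2 := (Complex.continuous_ofReal.tendsto 0).comp h1
    simpa [Function.comp_def] using h2
  have hg0 : Tendsto g l (𝓝 0) := by
    have h1 := hm'.mul hg
    rw [zero_mul] at h1
    refine h1.congr' ?_
    filter_upwards [hm.eventually_gt_atTop 0] with k hk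
    have : (m k : ℂ) ≠ 0 := by exact_mod_cast hk.ne'
    field_simp
  have hlog : (fun z : ℂ => Complex.log (1 + z) - z) =o[𝓝 0] fun z => z := by
    have h1 : HasDerivAt (fun z : ℂ => Complex.log (1 + z)) 1 0 := by
      have := ((hasDerivAt_id (0 : ℂ)).const_add 1).clog (by simp)
      simpa using this
    simpa using hasDerivAt_iff_isLittleO.1 h1
  have h1 : Tendsto (fun k => (m k : ℂ) * (Complex.log (1 + g k) - g k)) l (𝓝 0) := by
    have h2 : (fun k => (m k : ℂ) * (Complex.log (1 + g k) - g k)) =o[l]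
        fun k => (m k : ℂ) * g k :=
      (Asymptotics.isBigO_refl _ _).mul_isLittleO (hlog.comp_tendsto hg0)
    exact (Asymptotics.isLittleO_one_iff ℝ).1 (h2.trans_isBigO (hg.isBigO_one ℝ))
  have h3 : Tendsto (fun k => (m k : ℂ) * Complex.log (1 + g k)) l (𝓝 t) := by
    have := h1.add hg
    rw [zero_add] at this
    refine this.congr fun k => by ring
  refine ((Complex.continuous_exp.tendsto t).comp h3).congr' ?_
  have hne : ∀ᶠ k in l, 1 + g k ≠ 0 := by
    have : Tendsto (fun k => 1 + g k) l (𝓝 (1 + 0)) := hg0.const_add 1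
    exact this.eventually_ne (by simp)
  filter_upwards [hne] with k hk
  simp only [Function.comp_apply]
  rw [Complex.exp_nat_mul, Complex.exp_log hk]

/-- The second-order expansion of the characteristic function at `0` makes the base `1 - Var(X) t² /
2 + o(t²)`. The scale `t` is not tied to `1 / √m`, because the second sample has `N` factors taken
at `√n / N`. -/
theorem MeasureTheory.MemLp.tendsto_charFun_pow {S : Type*} [MeasurableSpace S] {Q : Measure S}
    [IsProbabilityMeasure Q] {X : S → ℝ} (hX : MemLp X 2 Q) (h0 : ∫ s, X s ∂Q = 0)
    {ι : Type*} {l : Filter ι} {m : ι → ℕ} {t : ι → ℝ} {c : ℝ} (hm : Tendsto m l atTop)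
    (ht : Tendsto t l (𝓝 0)) (hc : Tendsto (fun k => (m k : ℝ) * t k ^ 2) l (𝓝 c)) :
    Tendsto (fun k => charFun (Q.map X) (t k) ^ m k) l
      (𝓝 (Complex.exp (-(c * variance X Q / 2 : ℝ)))) := by
  have hXm : AEMeasurable X Q := hX.aestronglyMeasurable.aemeasurable
  have : IsProbabilityMeasure (Q.map X) := Measure.isProbabilityMeasure_map hXm
  have hid : MemLp id 2 (Q.map X) := by
    rw [memLp_map_measure_iff (by fun_prop) hXm]
    exact hX
  have hvar : ∫ s, (X ^ 2) s ∂Q = variance X Q := by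
    rw [variance_of_integral_eq_zero hXm h0]
    rfl
  have htaylor : (fun t : ℝ => charFun (Q.map X) t - (1 - (variance X Q : ℂ) * t ^ 2 / 2))
      =o[𝓝 0] fun t : ℝ => t ^ 2 := by
    have h1 : (fun t : ℝ => charFun (Q.map X) t
        - taylorWithinEval (charFun (Q.map X)) 2 Set.univ 0 t) =o[𝓝 0] fun t : ℝ => (t - 0) ^ 2 :=
      taylor_isLittleO_univ (contDiff_charFun hid)
    simp only [taylorWithinEval_charFun_two_zero hXm hid, h0, hvar] at h1
    simpa using h1
  have h2 : Tendsto (fun k => (m k : ℂ) * (charFun (Q.map X) (t k)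
      - (1 - (variance X Q : ℂ) * (t k : ℂ) ^ 2 / 2))) l (𝓝 0) := by
    have h3 : (fun k => (m k : ℂ) * (charFun (Q.map X) (t k)
      - (1 - (variance X Q : ℂ) * (t k : ℂ) ^ 2 / 2))) =o[l] fun k => (m k : ℝ) * t k ^ 2 := by
      refine Asymptotics.IsBigO.mul_isLittleO ?_ (htaylor.comp_tendsto ht)
      exact Asymptotics.IsBigO.of_norm_le fun k => by simp
    exact (Asymptotics.isLittleO_one_iff ℝ).1 (h3.trans_isBigO (hc.isBigO_one ℝ))
  have h4 : Tendsto (fun k => (m k : ℂ) * (charFun (Q.map X) (t k) - 1)) l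
      (𝓝 (-(c * variance X Q / 2 : ℝ))) := by
    have h5 : Tendsto (fun k => ((-(((m k : ℝ) * t k ^ 2) * variance X Q / 2) : ℝ) : ℂ)) l
        (𝓝 ((-(c * variance X Q / 2) : ℝ) : ℂ)) :=
      (Complex.continuous_ofReal.tendsto _).comp (((hc.mul_const _).div_const 2).neg)
    have h6 := h2.add h5
    rw [zero_add, Complex.ofReal_neg] at h6
    refine h6.congr fun k => ?_
    push_cast
    ring
  refine (Complex.tendsto_one_add_pow_exp hm h4).congr fun k => ?_
  simp

/-- The scaled and centered sum `√n ((1/n) ∑_{i<n} (a(ξᵢ) - Qa) + (1/N) ∑_{n≤i<n+N} (b(ξᵢ) - Qb))`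
of a statistic `a` over a first sample and a statistic `b` over a second one. -/
noncomputable def PPI.twoSampleSum {S Ω E : Type*} [MeasurableSpace S] [NormedAddCommGroup E]
    [NormedSpace ℝ E] (Q : Measure S) (ξ : ℕ → Ω → S) (n N : ℕ) (a b : S → E) (ω : Ω) : E :=
  Real.sqrt n • ((1 / (n : ℝ)) • ∑ i ∈ Finset.range n, (a (ξ i ω) - ∫ s, a s ∂Q)
    + (1 / (N : ℝ)) • ∑ i ∈ Finset.Ico n (n + N), (b (ξ i ω) - ∫ s, b s ∂Q))

namespace PPI

variable {S Ω : Type*} [MeasurableSpace S] {mΩ : MeasurableSpace Ω} {Q : Measure S}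
  {P : Measure Ω} {ξ : ℕ → Ω → S} {n N : ℕ} {a b : S → ℝ}

theorem aemeasurable_twoSampleSum {E : Type*} [NormedAddCommGroup E] [NormedSpace ℝ E]
    [MeasurableSpace E] [BorelSpace E] [SecondCountableTopology E]
    (hξ : ∀ i, HasLaw (ξ i) Q P) {a b : S → E} (ha : AEMeasurable a Q) (hb : AEMeasurable b Q) :
    AEMeasurable (twoSampleSum Q ξ n N a b) P := by
  have h (c : S → E) (hc : AEMeasurable c Q) (i : ℕ) : AEMeasurable (fun ω => c (ξ i ω)) P :=
    ((hξ i).map_eq ▸ hc).comp_aemeasurable (hξ i).aemeasurable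
  have ha' := h a ha
  have hb' := h b hb
  unfold twoSampleSum
  exact (((Finset.aemeasurable_fun_sum _ fun i _ => (ha' i).sub_const _).const_smul _).add
    ((Finset.aemeasurable_fun_sum _ fun i _ => (hb' i).sub_const _).const_smul _)).const_smul _

/-- The summands of `twoSampleSum`. -/
noncomputable def twoSampleTerm (Q : Measure S) (n N : ℕ) (a b : S → ℝ) (i : ℕ) (s : S) : ℝ :=
  if i < n then Real.sqrt n / n * (a s - ∫ s, a s ∂Q) else Real.sqrt n / N * (b s - ∫ s, b s ∂Q)

theorem twoSampleSum_eq_sum (ω : Ω) :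
    twoSampleSum Q ξ n N a b ω
      = ∑ i ∈ Finset.range (n + N), twoSampleTerm Q n N a b i (ξ i ω) := by
  rw [← Finset.sum_range_add_sum_Ico _ (Nat.le_add_right n N)]
  have h1 : ∑ i ∈ Finset.range n, twoSampleTerm Q n N a b i (ξ i ω)
      = ∑ i ∈ Finset.range n, Real.sqrt n / n * (a (ξ i ω) - ∫ s, a s ∂Q) :=
    Finset.sum_congr rfl fun i hi => if_pos (Finset.mem_range.1 hi)
  have h2 : ∑ i ∈ Finset.Ico n (n + N), twoSampleTerm Q n N a b i (ξ i ω)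
      = ∑ i ∈ Finset.Ico n (n + N), Real.sqrt n / N * (b (ξ i ω) - ∫ s, b s ∂Q) :=
    Finset.sum_congr rfl fun i hi => if_neg (not_lt.2 (Finset.mem_Ico.1 hi).1)
  rw [h1, h2, ← Finset.mul_sum, ← Finset.mul_sum, twoSampleSum]
  simp only [smul_eq_mul]
  ring

variable [IsProbabilityMeasure Q]

theorem memLp_twoSampleTerm (ha : MemLp a 2 Q) (hb : MemLp b 2 Q) (i : ℕ) :
    MemLp (twoSampleTerm Q n N a b i) 2 Q := by
  unfold twoSampleTerm
  split_ifs
  · exact (ha.sub (memLp_const _)).const_mul _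
  · exact (hb.sub (memLp_const _)).const_mul _

theorem memLp_twoSampleTerm_comp (hξ : ∀ i, HasLaw (ξ i) Q P) (ha : MemLp a 2 Q)
    (hb : MemLp b 2 Q) (i : ℕ) : MemLp (twoSampleTerm Q n N a b i ∘ ξ i) 2 P := by
  refine MemLp.comp_of_map ?_ (hξ i).aemeasurable
  rw [(hξ i).map_eq]
  exact memLp_twoSampleTerm ha hb i

theorem iIndepFun_twoSampleTerm (hξ : ∀ i, HasLaw (ξ i) Q P) (hind : iIndepFun ξ P)
    (ha : MemLp a 2 Q) (hb : MemLp b 2 Q) :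
    iIndepFun (fun i => twoSampleTerm Q n N a b i ∘ ξ i) P :=
  hind.comp₀ _ (fun i => (hξ i).aemeasurable) fun i => by
    rw [(hξ i).map_eq]
    exact (memLp_twoSampleTerm ha hb i).aestronglyMeasurable.aemeasurable

theorem integral_twoSampleTerm (ha : MemLp a 2 Q) (hb : MemLp b 2 Q) (i : ℕ) :
    ∫ s, twoSampleTerm Q n N a b i s ∂Q = 0 := by
  have ha' : Integrable a Q := ha.integrable (by norm_num)
  have hb' : Integrable b Q := hb.integrable (by norm_num)
  unfold twoSampleTerm
  split_ifs
  · rw [integral_const_mul, integral_sub ha' (integrable_const _)]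
    simp
  · rw [integral_const_mul, integral_sub hb' (integrable_const _)]
    simp

theorem variance_twoSampleTerm (ha : MemLp a 2 Q) (hb : MemLp b 2 Q) (i : ℕ) :
    variance (twoSampleTerm Q n N a b i) Q
      = if i < n then (Real.sqrt n / n) ^ 2 * variance a Q
        else (Real.sqrt n / N) ^ 2 * variance b Q := by
  unfold twoSampleTerm
  split_ifs
  · rw [variance_const_mul, variance_sub_const ha.aestronglyMeasurable]
  · rw [variance_const_mul, variance_sub_const hb.aestronglyMeasurable]

theorem memLp_twoSampleSum (hξ : ∀ i, HasLaw (ξ i) Q P) (ha : MemLp a 2 Q) (hb : MemLp b 2 Q) :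
    MemLp (twoSampleSum Q ξ n N a b) 2 P := by
  have : twoSampleSum Q ξ n N a b
      = fun ω => ∑ i ∈ Finset.range (n + N), (twoSampleTerm Q n N a b i ∘ ξ i) ω :=
    funext twoSampleSum_eq_sum
  rw [this]
  exact memLp_finsetSum _ fun i _ => memLp_twoSampleTerm_comp hξ ha hb i

theorem integral_twoSampleSum [IsProbabilityMeasure P] (hξ : ∀ i, HasLaw (ξ i) Q P) (ha : MemLp a 2 Q)
    (hb : MemLp b 2 Q) : ∫ ω, twoSampleSum Q ξ n N a b ω ∂P = 0 := by
  simp_rw [twoSampleSum_eq_sum]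
  have hint (i : ℕ) : Integrable (fun ω => twoSampleTerm Q n N a b i (ξ i ω)) P :=
    (memLp_twoSampleTerm_comp hξ ha hb i).integrable (by norm_num)
  rw [integral_finsetSum _ fun i _ => hint i]
  refine Finset.sum_eq_zero fun i _ => ?_
  have := (hξ i).integral_comp (f := twoSampleTerm Q n N a b i)
    (memLp_twoSampleTerm ha hb i).aestronglyMeasurable
  simp only [Function.comp_def] at this
  rw [this, integral_twoSampleTerm ha hb]

/-- By independence, variances add: `n` terms with factor `(√n / n)²` and `N` terms with factor `(√n
/ N)²`. -/
theorem variance_twoSampleSum (hξ : ∀ i, HasLaw (ξ i) Q P) (hind : iIndepFun ξ P)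
    (ha : MemLp a 2 Q) (hb : MemLp b 2 Q) (hn : 0 < n) (hN : 0 < N) :
    variance (twoSampleSum Q ξ n N a b) P = variance a Q + n / N * variance b Q := by
  have : twoSampleSum Q ξ n N a b
      = ∑ i ∈ Finset.range (n + N), (twoSampleTerm Q n N a b i ∘ ξ i) := by
    ext ω
    rw [twoSampleSum_eq_sum, Finset.sum_apply]
    rfl
  rw [this, IndepFun.variance_sum (fun i _ => memLp_twoSampleTerm_comp hξ ha hb i)
    fun i _ j _ hij => (iIndepFun_twoSampleTerm hξ hind ha hb).indepFun hij]
  have hv (i : ℕ) : variance (twoSampleTerm Q n N a b i ∘ ξ i) P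
      = variance (twoSampleTerm Q n N a b i) Q := by
    rw [← variance_map _ (hξ i).aemeasurable, (hξ i).map_eq]
    rw [(hξ i).map_eq]
    exact (memLp_twoSampleTerm ha hb i).aestronglyMeasurable.aemeasurable
  simp_rw [hv, variance_twoSampleTerm ha hb]
  rw [← Finset.sum_range_add_sum_Ico _ (Nat.le_add_right n N),
    Finset.sum_congr rfl fun i hi => if_pos (Finset.mem_range.1 hi),
    Finset.sum_congr rfl fun i hi => if_neg (not_lt.2 (Finset.mem_Ico.1 hi).1)]
  simp only [Finset.sum_const, Finset.card_range, Nat.card_Ico, add_tsub_cancel_left,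
    nsmul_eq_mul, div_pow, Real.sq_sqrt (Nat.cast_nonneg n)]
  have h1 : (n : ℝ) ≠ 0 := by positivity
  have h2 : (N : ℝ) ≠ 0 := by positivity
  field_simp

/-- Chebyshev's inequality. The bound is non-asymptotic because it is applied to remainders `a`, `b`
that change with the sample size. -/
theorem measure_twoSampleSum_ge_le [IsProbabilityMeasure P] (hξ : ∀ i, HasLaw (ξ i) Q P) (hind : iIndepFun ξ P)
    (ha : MemLp a 2 Q) (hb : MemLp b 2 Q) (hn : 0 < n) (hN : 0 < N) {c : ℝ} (hc : 0 < c) :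
    P {ω | c ≤ |twoSampleSum Q ξ n N a b ω|}
      ≤ ENNReal.ofReal ((variance a Q + n / N * variance b Q) / c ^ 2) := by
  have := meas_ge_le_variance_div_sq (memLp_twoSampleSum (n := n) (N := N) hξ ha hb) hc
  rw [integral_twoSampleSum hξ ha hb, variance_twoSampleSum hξ hind ha hb hn hN] at this
  simpa using this

/-- Independence factors the characteristic function into an `n`-th and an `N`-th power. Evaluation
at `1` suffices: in the vector case the frequency is absorbed into `a` and `b`. -/
theorem tendsto_charFun_twoSampleSum [IsProbabilityMeasure P] (hξ : ∀ i, HasLaw (ξ i) Q P) (hind : iIndepFun ξ P)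
    (ha : MemLp a 2 Q) (hb : MemLp b 2 Q) {n N : ℕ → ℕ} (hn_pos : ∀ k, 0 < n k)
    (hN_pos : ∀ k, 0 < N k) (hn : Tendsto n atTop atTop) {r : ℝ}
    (hr : Tendsto (fun k => (n k : ℝ) / N k) atTop (𝓝 r)) :
    Tendsto (fun k => charFun (P.map (twoSampleSum Q ξ (n k) (N k) a b)) 1) atTop
      (𝓝 (Complex.exp (-((variance a Q + r * variance b Q) / 2 : ℝ)))) := by
  set a' : S → ℝ := fun s => a s - ∫ s, a s ∂Q with ha'
  set b' : S → ℝ := fun s => b s - ∫ s, b s ∂Q with hb'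
  have ha2 : MemLp a' 2 Q := ha.sub (memLp_const _)
  have hb2 : MemLp b' 2 Q := hb.sub (memLp_const _)
  have ha0 : ∫ s, a' s ∂Q = 0 := by
    rw [ha', integral_sub (ha.integrable (by norm_num)) (integrable_const _)]
    simp
  have hb0 : ∫ s, b' s ∂Q = 0 := by
    rw [hb', integral_sub (hb.integrable (by norm_num)) (integrable_const _)]
    simp
  have hprod (k : ℕ) : charFun (P.map (twoSampleSum Q ξ (n k) (N k) a b)) 1
      = charFun (Q.map a') (Real.sqrt (n k) / n k) ^ n k
        * charFun (Q.map b') (Real.sqrt (n k) / N k) ^ N k := by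
    have h1 : twoSampleSum Q ξ (n k) (N k) a b
        = ∑ i ∈ Finset.range (n k + N k), (twoSampleTerm Q (n k) (N k) a b i ∘ ξ i) := by
      ext ω
      rw [twoSampleSum_eq_sum, Finset.sum_apply]
      rfl
    have hm (i : ℕ) : AEMeasurable (twoSampleTerm Q (n k) (N k) a b i) (P.map (ξ i)) := by
      rw [(hξ i).map_eq]
      exact (memLp_twoSampleTerm ha hb i).aestronglyMeasurable.aemeasurable
    rw [h1, ((iIndepFun_twoSampleTerm hξ hind ha hb).restrict _).charFun_map_finsetSum_eq_prod
      fun i _ => (memLp_twoSampleTerm_comp hξ ha hb i).aestronglyMeasurable.aemeasurable,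
      Finset.prod_apply]
    have h2 (i : ℕ) : charFun (P.map (twoSampleTerm Q (n k) (N k) a b i ∘ ξ i)) 1
        = if i < n k then charFun (Q.map a') (Real.sqrt (n k) / n k)
          else charFun (Q.map b') (Real.sqrt (n k) / N k) := by
      rw [← AEMeasurable.map_map_of_aemeasurable (hm i) (hξ i).aemeasurable, (hξ i).map_eq]
      unfold twoSampleTerm
      split_ifs
      · rw [charFun_map_mul_comp ha2.aestronglyMeasurable.aemeasurable, mul_one]
      · rw [charFun_map_mul_comp hb2.aestronglyMeasurable.aemeasurable, mul_one]
    simp_rw [h2]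
    rw [← Finset.prod_range_mul_prod_Ico _ (Nat.le_add_right (n k) (N k)),
      Finset.prod_congr rfl fun i hi => if_pos (Finset.mem_range.1 hi),
      Finset.prod_congr rfl fun i hi => if_neg (not_lt.2 (Finset.mem_Ico.1 hi).1)]
    simp
  have hnR : Tendsto (fun k => (n k : ℝ)) atTop atTop := tendsto_natCast_atTop_atTop.comp hn
  have hninv : Tendsto (fun k => (Real.sqrt (n k))⁻¹) atTop (𝓝 0) :=
    tendsto_inv_atTop_zero.comp (Real.tendsto_sqrt_atTop.comp hnR)
  have hsq (k : ℕ) : Real.sqrt (n k) ^ 2 = n k := Real.sq_sqrt (Nat.cast_nonneg _)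
  have hspos (k : ℕ) : 0 < Real.sqrt (n k) := Real.sqrt_pos.2 (by exact_mod_cast hn_pos k)
  have hNR (k : ℕ) : 0 < (N k : ℝ) := by exact_mod_cast hN_pos k
  have hnR' (k : ℕ) : 0 < (n k : ℝ) := by exact_mod_cast hn_pos k
  -- Eventually `n / N ≤ |r| + 1`, so `N ≥ n / (|r| + 1)`.
  have hN : Tendsto N atTop atTop := by
    refine tendsto_natCast_atTop_iff (R := ℝ) |>.1 ?_
    have hlt : ∀ᶠ k in atTop, (n k : ℝ) / N k ≤ |r| + 1 :=
      hr.eventually_le_const (by linarith [le_abs_self r])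
    refine tendsto_atTop_mono' _ ?_ (hnR.atTop_div_const (by positivity : (0 : ℝ) < |r| + 1))
    filter_upwards [hlt] with k hk
    rw [div_le_iff₀ (hNR k)] at hk
    rw [div_le_iff₀ (by positivity)]
    linarith
  -- The constants `c` come from `n (√n / n)² = 1` and `N (√n / N)² = n / N → r`.
  have hA := ha2.tendsto_charFun_pow ha0 (t := fun k => Real.sqrt (n k) / n k) (c := 1) hn
    (hninv.congr fun k => by rw [Real.sqrt_div_self', one_div])
    (tendsto_const_nhds.congr fun k => by
      have := hnR' k
      rw [div_pow, hsq]
      field_simp)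
  have hB := hb2.tendsto_charFun_pow hb0 (t := fun k => Real.sqrt (n k) / N k) (c := r) hN
    (by
      have h1 := hninv.mul hr
      rw [zero_mul] at h1
      refine h1.congr fun k => ?_
      have := hsq k
      have := hspos k
      have := hNR k
      field_simp
      linarith)
    (hr.congr fun k => by
      have := hNR k
      rw [div_pow, hsq]
      field_simp)
  have hAB := hA.mul hB
  simp only [← hprod] at hAB
  convert! hAB using 2
  rw [← Complex.exp_add, ha', hb', variance_sub_const ha.aestronglyMeasurable,
    variance_sub_const hb.aestronglyMeasurable]
  congr 1
  push_cast
  ring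

end PPI

end TwoSample

namespace PPI

/-! ### Covariance matrices as quadratic forms. -/

section Covariance

variable {d : ℕ} {S : Type*} [MeasurableSpace S] {μ : Measure S} [IsFiniteMeasure μ]
  {V : S → EuclideanSpace ℝ (Fin d)}

theorem isHermitian_covMatrix {d : ℕ} {S : Type*} [MeasurableSpace S] (μ : Measure S)
    (V : S → EuclideanSpace ℝ (Fin d)) : (covMatrix V μ).IsHermitian := by
  ext i j
  simp [covMatrix, covariance_comm]

theorem dotProduct_covMatrix_mulVec (hV : MemLp V 2 μ) (c : EuclideanSpace ℝ (Fin d)) :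
    c.ofLp ⬝ᵥ (covMatrix V μ *ᵥ c.ofLp) = variance (fun s => inner ℝ c (V s)) μ := by
  have hVi (i : Fin d) : MemLp (fun s => c i * V s i) 2 μ := (hV.eval_piLp i).const_mul _
  rw [← covariance_self (hV.const_inner c).aestronglyMeasurable.aemeasurable]
  have : (fun s => inner ℝ c (V s)) = fun s => ∑ i, c i * V s i := by
    ext s
    simp [PiLp.inner_apply, mul_comm]
  rw [this, covariance_fun_sum_fun_sum hVi hVi]
  simp only [covariance_const_mul_left, covariance_const_mul_right, dotProduct, Matrix.mulVec,
    covMatrix, Matrix.of_apply, Finset.mul_sum]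
  exact Finset.sum_congr rfl fun i _ => Finset.sum_congr rfl fun j _ => by ring

theorem posSemidef_covMatrix (hV : MemLp V 2 μ) : (covMatrix V μ).PosSemidef := by
  refine Matrix.PosSemidef.of_dotProduct_mulVec_nonneg (isHermitian_covMatrix μ V) fun x => ?_
  have := dotProduct_covMatrix_mulVec hV (WithLp.toLp 2 x)
  simp only [star_trivial]
  simp only at this
  rw [this]
  exact variance_nonneg _ _

end Covariance

theorem posSemidef_inv_mul_mul_inv {d : ℕ} {H V : Matrix (Fin d) (Fin d) ℝ} (hH : H.IsHermitian)
    (hV : V.PosSemidef) : (H⁻¹ * V * H⁻¹).PosSemidef := by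
  have := hV.mul_mul_conjTranspose_same H⁻¹
  rwa [hH.inv.eq] at this

/-! ### First-order remainder of a regular loss. -/

section Remainder

variable {d : ℕ} {S : Type*} [MeasurableSpace S] {Θ : Set (EuclideanSpace ℝ (Fin d))}
  {m : EuclideanSpace ℝ (Fin d) → S → ℝ} {θ₀ : EuclideanSpace ℝ (Fin d)} {μ : Measure S}

/-- The remainder of the first order expansion of a loss, scaled by `c`. -/
noncomputable def lossRemainder (m : EuclideanSpace ℝ (Fin d) → S → ℝ)
    (θ₀ h : EuclideanSpace ℝ (Fin d)) (c : ℝ) (s : S) : ℝ :=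
  c * (m (θ₀ + c⁻¹ • h) s - m θ₀ s) - inner ℝ h (lossGradient m θ₀ s)

theorem tendsto_lossRemainder {d : ℕ} {S : Type*} {m : EuclideanSpace ℝ (Fin d) → S → ℝ}
    {θ₀ : EuclideanSpace ℝ (Fin d)} {s : S} (hd : DifferentiableAt ℝ (fun θ => m θ s) θ₀)
    (h : EuclideanSpace ℝ (Fin d)) :
    Tendsto (fun c => lossRemainder m θ₀ h c s) atTop (𝓝 0) := by
  have h1 := hd.hasFDerivAt.lim_real h
  rw [← inner_gradient_left, real_inner_comm] at h1
  simpa [lossRemainder, lossGradient] using h1.sub_const (inner ℝ h (lossGradient m θ₀ s))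

theorem tendsto_add_inv_smul (θ₀ h : EuclideanSpace ℝ (Fin d)) :
    Tendsto (fun c : ℝ => θ₀ + c⁻¹ • h) atTop (𝓝 θ₀) := by
  simpa using ((tendsto_inv_atTop_zero (𝕜 := ℝ)).smul_const h).const_add θ₀

/-- The local Lipschitz bound supplies one square-integrable envelope for the difference quotients
in every direction, used both for the gradient and for dominated convergence. -/
theorem RegularLoss.exists_bound_difference_quotient (hm : RegularLoss Θ m θ₀ μ) :
    ∃ M : S → ℝ, MemLp M 2 μ ∧ ∀ h : EuclideanSpace ℝ (Fin d), ∀ᶠ c in atTop,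
      ∀ᵐ s ∂μ, |c * (m (θ₀ + c⁻¹ • h) s - m θ₀ s)| ≤ M s * ‖h‖ := by
  obtain ⟨U, hU, M, hM, hlip⟩ := hm.lipschitz
  refine ⟨M, hM, fun h => ?_⟩
  filter_upwards [(tendsto_add_inv_smul θ₀ h).eventually hU, eventually_gt_atTop 0] with c hc hc0
  filter_upwards [hlip] with s hs
  have h1 := hs _ hc _ (mem_of_mem_nhds hU)
  rw [abs_mul, abs_of_pos hc0]
  calc c * |m (θ₀ + c⁻¹ • h) s - m θ₀ s| ≤ c * (M s * ‖θ₀ + c⁻¹ • h - θ₀‖) := by gcongr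
    _ = M s * ‖h‖ := by
      rw [add_sub_cancel_left, norm_smul, norm_inv, Real.norm_of_nonneg hc0.le]
      field_simp

theorem RegularLoss.eventually_aestronglyMeasurable (hm : RegularLoss Θ m θ₀ μ)
    (hθ₀ : θ₀ ∈ interior Θ) (h : EuclideanSpace ℝ (Fin d)) :
    ∀ᶠ c : ℝ in atTop, AEStronglyMeasurable
      (fun s => c * (m (θ₀ + c⁻¹ • h) s - m θ₀ s)) μ := by
  filter_upwards [(tendsto_add_inv_smul θ₀ h).eventually (mem_interior_iff_mem_nhds.1 hθ₀)]
    with c hc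
  exact ((hm.integrable _ hc).sub
    (hm.integrable _ (interior_subset hθ₀))).aestronglyMeasurable.const_mul _

/-- Measurability of the gradient is not part of regularity: it is inherited from difference
quotients along the sequence `c = K + j`, with `K` so large that each quotient is measurable and
below the envelope. The envelope then bounds the limit. -/
theorem RegularLoss.memLp_inner_lossGradient (hm : RegularLoss Θ m θ₀ μ)
    (hθ₀ : θ₀ ∈ interior Θ) (h : EuclideanSpace ℝ (Fin d)) :
    MemLp (fun s => inner ℝ h (lossGradient m θ₀ s)) 2 μ := by
  obtain ⟨M, hM, hbound⟩ := hm.exists_bound_difference_quotient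
  obtain ⟨K, hK⟩ := eventually_atTop.1
    ((hm.eventually_aestronglyMeasurable hθ₀ h).and (hbound h))
  have hKt : Tendsto (fun j : ℕ => K + j) atTop atTop :=
    tendsto_atTop_add_const_left _ _ tendsto_natCast_atTop_atTop
  have hle (j : ℕ) : K ≤ K + j := by simp
  have hlim : ∀ᵐ s ∂μ, Tendsto (fun j : ℕ => (K + j) * (m (θ₀ + (K + j : ℝ)⁻¹ • h) s - m θ₀ s))
      atTop (𝓝 (inner ℝ h (lossGradient m θ₀ s))) := by
    filter_upwards [hm.differentiable] with s hs
    have := ((tendsto_lossRemainder hs h).comp hKt).add_const (inner ℝ h (lossGradient m θ₀ s))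
    simpa [lossRemainder, Function.comp_def] using this
  refine hM.of_le_mul (c := ‖h‖)
    (aestronglyMeasurable_of_tendsto_ae atTop (fun j => (hK _ (hle j)).1) hlim) ?_
  filter_upwards [hlim, ae_all_iff.2 fun j : ℕ => (hK _ (hle j)).2] with s hs hb
  rw [Real.norm_eq_abs, Real.norm_eq_abs]
  refine le_of_tendsto hs.abs (Eventually.of_forall fun j => (hb j).trans ?_)
  rw [mul_comm]
  gcongr
  exact le_abs_self _

theorem RegularLoss.memLp_lossGradient (hm : RegularLoss Θ m θ₀ μ) (hθ₀ : θ₀ ∈ interior Θ) :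
    MemLp (lossGradient m θ₀) 2 μ := by
  refine MemLp.of_eval_piLp fun i => ?_
  simpa [EuclideanSpace.inner_single_left] using
    hm.memLp_inner_lossGradient hθ₀ (EuclideanSpace.single i 1)

theorem RegularLoss.hasSquareIntegrableGradient (hm : RegularLoss Θ m θ₀ μ)
    (hθ₀ : θ₀ ∈ interior Θ) : HasSquareIntegrableGradient m θ₀ μ :=
  ⟨hm.differentiable, hm.memLp_lossGradient hθ₀⟩

theorem RegularLoss.eventually_memLp_lossRemainder (hm : RegularLoss Θ m θ₀ μ)
    (hθ₀ : θ₀ ∈ interior Θ) (h : EuclideanSpace ℝ (Fin d)) :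
    ∀ᶠ c in atTop, MemLp (lossRemainder m θ₀ h c) 2 μ := by
  obtain ⟨M, hM, hbound⟩ := hm.exists_bound_difference_quotient
  filter_upwards [hm.eventually_aestronglyMeasurable hθ₀ h, hbound h] with c hc hb
  refine MemLp.sub (hM.of_le_mul (c := ‖h‖) hc ?_) (hm.memLp_inner_lossGradient hθ₀ h)
  filter_upwards [hb] with s hs
  rw [Real.norm_eq_abs, Real.norm_eq_abs, mul_comm ‖h‖]
  exact hs.trans (by gcongr; exact le_abs_self _)

/-- Dominated convergence: differentiability gives the pointwise limit, and the Lipschitz envelope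
plus the gradient dominates. -/
theorem RegularLoss.tendsto_integral_lossRemainder_sq (hm : RegularLoss Θ m θ₀ μ)
    (hθ₀ : θ₀ ∈ interior Θ) (h : EuclideanSpace ℝ (Fin d)) :
    Tendsto (fun c => ∫ s, lossRemainder m θ₀ h c s ^ 2 ∂μ) atTop (𝓝 0) := by
  obtain ⟨M, hM, hbound⟩ := hm.exists_bound_difference_quotient
  have hG := hm.memLp_inner_lossGradient hθ₀ h
  have hlim := tendsto_integral_filter_of_dominated_convergence (μ := μ) (l := atTop)
    (F := fun c s => lossRemainder m θ₀ h c s ^ 2) (f := fun _ => 0)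
    (fun s => (|M s| * ‖h‖ + |inner ℝ h (lossGradient m θ₀ s)|) ^ 2)
    ?_ ?_ ?_ ?_
  · simpa using hlim
  · filter_upwards [hm.eventually_memLp_lossRemainder hθ₀ h] with c hc
    exact hc.aestronglyMeasurable.pow 2
  · filter_upwards [hbound h] with c hc
    filter_upwards [hc] with s hs
    rw [norm_pow, Real.norm_eq_abs]
    gcongr
    refine (abs_sub _ _).trans ?_
    gcongr
    exact hs.trans (by gcongr; exact le_abs_self _)
  · exact ((hM.abs.mul_const _).add hG.abs).integrable_sq
  · filter_upwards [hm.differentiable] with s hs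
    simpa using (tendsto_lossRemainder hs h).pow 2

end Remainder

end PPI

/-! ### Optimality of the projected gradient. -/

namespace PPI

theorem covariance_congr_left {S : Type*} [MeasurableSpace S] {Q : Measure S} {U U' V : S → ℝ}
    (h : U =ᵐ[Q] U') : covariance U V Q = covariance U' V Q := by
  rw [covariance, covariance, integral_congr_ae h]
  refine integral_congr_ae ?_
  filter_upwards [h] with s hs
  rw [hs]

/-- Conditional expectation is the orthogonal projection in `L²`: pull `V` inside, then integrate.
-/
theorem covariance_condExp_left {S : Type*} {m mS : MeasurableSpace S} (hm : m ≤ mS)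
    {Q : Measure S} [IsProbabilityMeasure Q] {U V : S → ℝ} (hU : MemLp U 2 Q) (hV : MemLp V 2 Q)
    (hVm : AEStronglyMeasurable[m] V Q) :
    covariance (condExp m Q U) V Q = covariance U V Q := by
  rw [covariance_eq_sub (hU.condExp (by norm_num)) hV, covariance_eq_sub hU hV,
    integral_condExp hm]
  congr 1
  have h1 : Integrable (U * V) Q := hU.integrable_mul hV
  have h2 := condExp_mul_of_aestronglyMeasurable_right hVm h1 (hU.integrable (by norm_num))
  rw [← integral_congr_ae h2, integral_condExp hm]

section Decomposition

variable {d : ℕ} {S : Type*} {m mS : MeasurableSpace S} {Q : Measure S} [IsProbabilityMeasure Q]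
  {u v : S → EuclideanSpace ℝ (Fin d)}

theorem covariance_condExp_apply_left (hm : m ≤ mS) (hu : MemLp u 2 Q) {V : S → ℝ}
    (hV : MemLp V 2 Q) (hVm : AEStronglyMeasurable[m] V Q) (i : Fin d) :
    covariance (fun z => condExp m Q u z i) V Q = covariance (fun z => u z i) V Q := by
  rw [← covariance_condExp_left hm (hu.eval_piLp i) hV hVm]
  refine covariance_congr_left ?_
  exact (EuclideanSpace.proj (𝕜 := ℝ) i).comp_condExp_comm (hu.integrable (by norm_num))

/-- Completing the square in the asymptotic variance. -/
theorem smul_covMatrix_add_covMatrix_sub (hm : m ≤ mS) (hu : MemLp u 2 Q) (hv : MemLp v 2 Q)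
    (hvm : AEStronglyMeasurable[m] v Q) {r : ℝ} (hr : 0 ≤ r) :
    r • covMatrix v Q + covMatrix (fun z => u z - v z) Q
      = covMatrix u Q - (1 / (1 + r)) • covMatrix (condExp m Q u) Q
        + (1 + r) • covMatrix (fun z => v z - (1 / (1 + r)) • condExp m Q u z) Q := by
  have hs : MemLp (condExp m Q u) 2 Q := hu.condExp (by norm_num)
  ext i j
  have hvmi (i : Fin d) : AEStronglyMeasurable[m] (fun z => v z i) Q :=
    (EuclideanSpace.proj (𝕜 := ℝ) i).continuous.comp_aestronglyMeasurable hvm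
  -- Since `v` is `m`-measurable, the cross terms see only `condExp m Q u`; after this replacement
  -- the identity is bilinear algebra.
  have huv : covariance (fun z => u z i) (fun z => v z j) Q
      = covariance (fun z => condExp m Q u z i) (fun z => v z j) Q :=
    (covariance_condExp_apply_left hm hu (hv.eval_piLp j) (hvmi j) i).symm
  have hvu : covariance (fun z => v z i) (fun z => u z j) Q
      = covariance (fun z => v z i) (fun z => condExp m Q u z j) Q := by
    rw [covariance_comm, covariance_comm (fun z => v z i)]
    exact (covariance_condExp_apply_left hm hu (hv.eval_piLp i) (hvmi i) j).symm
  simp only [Matrix.add_apply, Matrix.sub_apply, Matrix.smul_apply, covMatrix, Matrix.of_apply,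
    PiLp.sub_apply, PiLp.smul_apply, smul_eq_mul]
  rw [covariance_fun_sub_fun_sub (hu.eval_piLp i) (hv.eval_piLp i) (hu.eval_piLp j)
    (hv.eval_piLp j), covariance_fun_sub_fun_sub (hv.eval_piLp i) ((hs.eval_piLp i).const_mul _)
    (hv.eval_piLp j) ((hs.eval_piLp j).const_mul _), covariance_const_mul_left,
    covariance_const_mul_left, covariance_const_mul_right, covariance_const_mul_right, huv, hvu]
  have : 1 + r ≠ 0 := by positivity
  field_simp
  ring

end Decomposition

section Optimality

variable {d : ℕ} {𝒳 𝒲 𝒴 𝒵 : Type*}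
  [MeasurableSpace 𝒳] [MeasurableSpace 𝒲] [MeasurableSpace 𝒴] [MeasurableSpace 𝒵]
  {Q : Measure (𝒳 × 𝒲 × 𝒴)} [IsProbabilityMeasure Q] {f : 𝒳 → 𝒲 → 𝒵}
  {ℓ : EuclideanSpace ℝ (Fin d) → 𝒳 × 𝒴 → ℝ} {g : EuclideanSpace ℝ (Fin d) → 𝒳 × 𝒵 → ℝ}
  {θ : EuclideanSpace ℝ (Fin d)} {r : ℝ}

theorem measurable_toXY : Measurable (toXY : 𝒳 × 𝒲 × 𝒴 → 𝒳 × 𝒴) := by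
  unfold toXY
  fun_prop

theorem measurable_toXYhat (hf : Measurable (fun p : 𝒳 × 𝒲 => f p.1 p.2)) :
    Measurable (toXYhat f : 𝒳 × 𝒲 × 𝒴 → 𝒳 × 𝒵) := by
  have h1 : Measurable (fun z : 𝒳 × 𝒲 × 𝒴 => (z.1, z.2.1)) := by fun_prop
  exact measurable_fst.prodMk (hf.comp h1)

/-- Isolates the dependence on `g` in one positive semidefinite term, so that both the optimal value
and the comparison with `g'` can be read off. -/
theorem asymCov_eq_add (hf : Measurable (fun p : 𝒳 × 𝒲 => f p.1 p.2))
    (hℓ : HasSquareIntegrableGradient ℓ θ (Q.map toXY))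
    (hg : HasSquareIntegrableGradient g θ (Q.map (toXYhat f))) (hr : 0 ≤ r) :
    asymCov ℓ g f Q r θ
      = (lossHessian ℓ Q θ)⁻¹ *
          (covMatrix (fun z => lossGradient ℓ θ (toXY z)) Q
            - (1 / (1 + r)) • covMatrix (condGradient ℓ f Q θ) Q) * (lossHessian ℓ Q θ)⁻¹
        + (1 + r) • ((lossHessian ℓ Q θ)⁻¹ *
          covMatrix (fun z => lossGradient g θ (toXYhat f z)
            - (1 / (1 + r)) • condGradient ℓ f Q θ z) Q * (lossHessian ℓ Q θ)⁻¹) := by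
  have hp := measurable_toXYhat (𝒴 := 𝒴) hf
  have key := smul_covMatrix_add_covMatrix_sub hp.comap_le
    (hℓ.2.comp_of_map measurable_toXY.aemeasurable) (hg.2.comp_of_map hp.aemeasurable)
    (hg.2.aestronglyMeasurable.comp_ae_measurable' hp.aemeasurable) hr
  simp only [Function.comp_def] at key
  rw [asymCov, key, mul_add, add_mul, Matrix.mul_smul, Matrix.smul_mul]
  rfl

theorem asymCov_eq_of_gradient_eq (hf : Measurable (fun p : 𝒳 × 𝒲 => f p.1 p.2))
    (hℓ : HasSquareIntegrableGradient ℓ θ (Q.map toXY))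
    (hg : HasSquareIntegrableGradient g θ (Q.map (toXYhat f))) (hr : 0 ≤ r)
    (h : ∀ᵐ z ∂Q, lossGradient g θ (toXYhat f z) = (1 / (1 + r)) • condGradient ℓ f Q θ z) :
    asymCov ℓ g f Q r θ
      = (lossHessian ℓ Q θ)⁻¹ *
          (covMatrix (fun z => lossGradient ℓ θ (toXY z)) Q
            - (1 / (1 + r)) • covMatrix (condGradient ℓ f Q θ) Q) * (lossHessian ℓ Q θ)⁻¹ := by
  rw [asymCov_eq_add hf hℓ hg hr]
  have h0 : covMatrix (fun z => lossGradient g θ (toXYhat f z)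
            - (1 / (1 + r)) • condGradient ℓ f Q θ z) Q = 0 := by
    ext i j
    have hi : (fun z => (lossGradient g θ (toXYhat f z)
            - (1 / (1 + r)) • condGradient ℓ f Q θ z) i) =ᵐ[Q] 0 := by
      filter_upwards [h] with z hz
      simp [hz]
    simp only [covMatrix, Matrix.of_apply, Matrix.zero_apply]
    rw [covariance_congr_left hi, covariance_zero_left]
  rw [h0]
  simp

theorem posSemidef_asymCov_sub (hf : Measurable (fun p : 𝒳 × 𝒲 => f p.1 p.2))
    (hℓ : HasSquareIntegrableGradient ℓ θ (Q.map toXY)) (hH : (lossHessian ℓ Q θ).IsHermitian)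
    (hg : HasSquareIntegrableGradient g θ (Q.map (toXYhat f))) (hr : 0 ≤ r)
    (h : ∀ᵐ z ∂Q, lossGradient g θ (toXYhat f z) = (1 / (1 + r)) • condGradient ℓ f Q θ z)
    {g' : EuclideanSpace ℝ (Fin d) → 𝒳 × 𝒵 → ℝ}
    (hg' : HasSquareIntegrableGradient g' θ (Q.map (toXYhat f))) :
    (asymCov ℓ g' f Q r θ - asymCov ℓ g f Q r θ).PosSemidef := by
  rw [asymCov_eq_of_gradient_eq hf hℓ hg hr h, asymCov_eq_add hf hℓ hg' hr, add_sub_cancel_left]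
  refine (posSemidef_inv_mul_mul_inv hH (posSemidef_covMatrix ?_)).smul (by positivity)
  have hs : MemLp (condGradient ℓ f Q θ) 2 Q :=
    (hℓ.2.comp_of_map measurable_toXY.aemeasurable).condExp (by norm_num)
  exact (hg'.2.comp_of_map (measurable_toXYhat hf).aemeasurable).sub
    (hs.const_smul (1 / (1 + r)))

theorem posSemidef_asymCov (hf : Measurable (fun p : 𝒳 × 𝒲 => f p.1 p.2))
    (hℓ : HasSquareIntegrableGradient ℓ θ (Q.map toXY)) (hH : (lossHessian ℓ Q θ).IsHermitian)
    (hg : HasSquareIntegrableGradient g θ (Q.map (toXYhat f))) (hr : 0 ≤ r) :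
    (asymCov ℓ g f Q r θ).PosSemidef := by
  have hℓ2 := hℓ.2.comp_of_map (measurable_toXY (𝒲 := 𝒲)).aemeasurable
  have hg2 := hg.2.comp_of_map (measurable_toXYhat (𝒴 := 𝒴) hf).aemeasurable
  exact posSemidef_inv_mul_mul_inv hH
    (((posSemidef_covMatrix hg2).smul hr).add (posSemidef_covMatrix (hℓ2.sub hg2)))

end Optimality

end PPI

/-! ### Minimizers of random convex functions. -/

section ConvexEstimation

variable {E : Type*} [NormedAddCommGroup E] [InnerProductSpace ℝ E] [FiniteDimensional ℝ E]

/-- If a convex function is uniformly close to a strictly convex quadratic function around its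
minimizer `w`, then it has minimizers, and all of them are close to `w`. -/
theorem ConvexOn.exists_isMinOn_of_abs_sub_quadratic_le {C : Set E} {G : E → ℝ}
    (hG : ConvexOn ℝ C G) {A : E →L[ℝ] E} (hA : ∀ x y, inner ℝ (A x) y = inner ℝ x (A y))
    {w : E} {ε R η : ℝ} (hε : 0 < ε) (hC : Metric.closedBall 0 R ⊆ interior C)
    (hw : ‖w‖ + ε ≤ R)
    (hclose : ∀ x ∈ Metric.closedBall 0 R, |G x - inner ℝ x (-A w) - inner ℝ x (A x) / 2| ≤ η)
    (hpos : ∀ x ∈ Metric.sphere (0 : E) ε, 2 * η < inner ℝ x (A x) / 2) :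
    (∃ x ∈ C, IsMinOn G C x) ∧ ∀ x ∈ C, IsMinOn G C x → ‖x - w‖ < ε := by
  have hsub : Metric.closedBall w ε ⊆ Metric.closedBall 0 R := by
    intro x hx
    rw [mem_closedBall_iff_norm] at hx
    rw [mem_closedBall_zero_iff]
    have := norm_add_le (x - w) w
    rw [sub_add_cancel] at this
    linarith
  refine hG.exists_isMinOn_of_lt_sphere hε (hsub.trans hC) fun x hx => ?_
  have h1 := (abs_le.1 (hclose x (hsub (Metric.sphere_subset_closedBall hx)))).1
  have h2 := (abs_le.1 (hclose w (hsub (Metric.mem_closedBall_self hε.le)))).2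
  -- By symmetry of `A`, the quadratic at `x` exceeds its value at `w` by exactly `⟨x - w, A (x -
  -- w)⟩ / 2`; the approximation errors at `x` and `w` cost at most `2 * η`.
  have h3 := hpos (x - w) (by simpa [mem_sphere_iff_norm] using hx)
  have h4 := hA w x
  rw [real_inner_comm] at h4
  simp only [map_sub, inner_sub_left, inner_sub_right, inner_neg_right] at h1 h2 h3
  linarith

/-- Minimizers of random convex functions with a local quadratic expansion (Hjort-Pollard). -/
theorem tendstoInMeasure_argmin_of_convexOn {Ω : Type*} [MeasurableSpace Ω] {P : Measure Ω}
    {Θ : Set E} {θ₀ : E} (hθ₀ : θ₀ ∈ interior Θ) {obj : ℕ → Ω → E → ℝ}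
    (hconv : ∀ k, ∀ᵐ ω ∂P, ConvexOn ℝ Θ (obj k ω)) {s : ℕ → ℝ} (hs_pos : ∀ k, 0 < s k)
    (hs : Tendsto s atTop atTop) {A : E →L[ℝ] E} (hA : ∀ x y, inner ℝ (A x) y = inner ℝ x (A y))
    (hApos : ∀ x, x ≠ 0 → 0 < inner ℝ x (A x)) {W : ℕ → Ω → E}
    (htight : ∀ η : ℝ≥0∞, 0 < η → ∃ K : ℝ, ∀ k, P {ω | K < ‖W k ω‖} ≤ η)
    (hexp : ∀ h : E, ∀ δ > 0, Tendsto (fun k => P {ω | δ ≤ |s k ^ 2 *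
      (obj k ω (θ₀ + (s k)⁻¹ • h) - obj k ω θ₀) - inner ℝ h (-A (W k ω)) - inner ℝ h (A h) / 2|})
      atTop (𝓝 0))
    {θhat : ℕ → Ω → E} (hmin : ∀ k, ∀ᵐ ω ∂P, (PPI.argminOn Θ (obj k ω)).Nonempty →
      θhat k ω ∈ PPI.argminOn Θ (obj k ω)) :
    TendstoInMeasure P ((fun k ω => s k • (θhat k ω - θ₀)) - W) atTop 0 := by
  rw [tendstoInMeasure_iff_norm]
  intro ε hε
  have hcont : Continuous fun x : E => inner ℝ x (A x) / 2 := by fun_prop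
  -- `c` is a positive lower bound for the quadratic on the sphere of radius `ε`; approximation
  -- within `c / 3` leaves a positive gap.
  obtain ⟨c, hc, hcle⟩ := (isCompact_sphere (0 : E) ε).exists_forall_le' (a := (0 : ℝ))
    hcont.continuousOn fun x hx => by
      have hx0 : x ≠ 0 := by
        rintro rfl
        simp [hε.ne] at hx
      exact div_pos (hApos x hx0) two_pos
  rw [ENNReal.tendsto_atTop_zero]
  intro η hη
  have hη2 : 0 < η / 2 := ENNReal.half_pos hη.ne'
  obtain ⟨K, hK⟩ := htight (η / 2) hη2
  -- Large enough that the `ε`-ball around `W k ω` lies in the `R`-ball whenever `‖W k ω‖ ≤ K`.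
  set R := |K| + ε with hR
  obtain ⟨F, δ, hδ, R', hunif⟩ := exists_finset_forall_convexOn_abs_sub_le hcont R
    (η := c / 3) (by positivity)
  have hsum : Tendsto (fun k => ∑ h ∈ F, P {ω | δ ≤ |s k ^ 2 *
      (obj k ω (θ₀ + (s k)⁻¹ • h) - obj k ω θ₀) - inner ℝ h (-A (W k ω)) - inner ℝ h (A h) / 2|})
      atTop (𝓝 0) := by
    simpa using tendsto_finsetSum F fun h _ => hexp h δ hδ
  have hball : ∀ᶠ k in atTop, ∀ h ∈ Metric.closedBall (0 : E) (max R R' + 1),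
      θ₀ + (s k)⁻¹ • h ∈ Θ := by
    obtain ⟨ρ, hρ, hρΘ⟩ := Metric.isOpen_iff.1 isOpen_interior θ₀ hθ₀
    have hD : 0 < |max R R' + 1| + 1 := by positivity
    filter_upwards [hs.eventually_gt_atTop ((|max R R' + 1| + 1) / ρ)] with k hk h hh
    refine interior_subset (hρΘ ?_)
    rw [mem_closedBall_zero_iff] at hh
    rw [mem_ball_iff_norm, add_sub_cancel_left, norm_smul, norm_inv,
      Real.norm_of_nonneg (hs_pos k).le, inv_mul_lt_iff₀ (hs_pos k)]
    rw [div_lt_iff₀ hρ] at hk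
    linarith [le_abs_self (max R R' + 1)]
  obtain ⟨k₀, hk₀⟩ := eventually_atTop.1 (hball.and (hsum.eventually_le_const hη2))
  refine ⟨k₀, fun k hk => ?_⟩
  obtain ⟨hkΘ, hkP⟩ := hk₀ k hk
  set C : Set E := (fun h => θ₀ + (s k)⁻¹ • h) ⁻¹' Θ with hCdef
  have hCball : Metric.closedBall (0 : E) (max R R') ⊆ interior C := by
    refine subset_trans (Metric.closedBall_subset_ball (lt_add_one _)) ?_
    exact interior_maximal (fun h hh => hkΘ h (Metric.ball_subset_closedBall hh))
      Metric.isOpen_ball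
  have hincl : P {ω | ε ≤ ‖((fun k ω => s k • (θhat k ω - θ₀)) - W) k ω - (0 : Ω → E) ω‖}
      ≤ P ({ω | K < ‖W k ω‖} ∪ ⋃ h ∈ F, {ω | δ ≤ |s k ^ 2 *
      (obj k ω (θ₀ + (s k)⁻¹ • h) - obj k ω θ₀) - inner ℝ h (-A (W k ω))
        - inner ℝ h (A h) / 2|}) := by
    refine measure_mono_ae ?_
    filter_upwards [hconv k, hmin k] with ω hconvω hminω hω
    by_contra hnot
    have hnot' : ω ∉ {ω | K < ‖W k ω‖} ∪ ⋃ h ∈ F, {ω | δ ≤ |s k ^ 2 *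
      (obj k ω (θ₀ + (s k)⁻¹ • h) - obj k ω θ₀) - inner ℝ h (-A (W k ω))
        - inner ℝ h (A h) / 2|} := hnot
    simp only [Set.mem_union, Set.mem_iUnion, Set.mem_ofPred_eq, not_or, not_lt, not_exists,
      not_le] at hnot'
    obtain ⟨hWK, hF⟩ := hnot'
    have hω' : ε ≤ ‖s k • (θhat k ω - θ₀) - W k ω - 0‖ := hω
    rw [sub_zero] at hω'
    set G : E → ℝ := fun h => s k ^ 2 * (obj k ω (θ₀ + (s k)⁻¹ • h) - obj k ω θ₀) with hGdef
    have hG : ConvexOn ℝ C G := by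
      have h1 := hconvω.comp_affineMap
        (AffineMap.const ℝ E θ₀ + ((s k)⁻¹ • (LinearMap.id : E →ₗ[ℝ] E)).toAffineMap)
      have h2 := (h1.add_const (-obj k ω θ₀)).smul (sq_nonneg (s k))
      exact h2
    -- Removing the random linear term keeps convexity and leaves a deterministic target, so one
    -- finite set `F` serves all `k` and `ω`.
    have hφ : ConvexOn ℝ (Metric.closedBall 0 R')
        (fun h => G h - inner ℝ h (-A (W k ω))) := by
      have h1 := hG.subset (s := Metric.closedBall 0 R') ((Metric.closedBall_subset_closedBall
        (le_max_right _ _)).trans (hCball.trans interior_subset)) (convex_closedBall _ _)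
      have h2 : ConvexOn ℝ (Metric.closedBall 0 R') (fun h : E => inner ℝ (A (W k ω)) h) :=
        (innerₗ E (A (W k ω))).convexOn (convex_closedBall _ _)
      refine (h1.add h2).congr fun h _ => ?_
      simp [inner_neg_right, real_inner_comm]
    have hclose := hunif _ hφ fun p hp => (hF p hp).le
    have hCR : Metric.closedBall (0 : E) R ⊆ interior C :=
      (Metric.closedBall_subset_closedBall (le_max_left _ _)).trans hCball
    obtain ⟨⟨x, hxC, hx⟩, hall⟩ := hG.exists_isMinOn_of_abs_sub_quadratic_le hA hε hCR
      (by rw [hR]; linarith [le_abs_self K]) hclose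
      (fun x hx => by linarith [hcle x hx])
    have hs0 : s k ≠ 0 := (hs_pos k).ne'
    have hsq : 0 < s k ^ 2 := pow_pos (hs_pos k) 2
    have hback (θ : E) : θ₀ + (s k)⁻¹ • (s k • (θ - θ₀)) = θ := by
      rw [inv_smul_smul₀ hs0, add_sub_cancel]
    -- Rescaling the minimizer of `G` shows that the objective has one, which is what makes `θhat k
    -- ω` a minimizer.
    have hne : (PPI.argminOn Θ (obj k ω)).Nonempty := by
      refine ⟨θ₀ + (s k)⁻¹ • x, hxC, fun θ hθ => ?_⟩
      have h1 : G x ≤ G (s k • (θ - θ₀)) := hx (by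
        change θ₀ + (s k)⁻¹ • (s k • (θ - θ₀)) ∈ Θ
        rwa [hback])
      simp only [hGdef, hback] at h1
      have h2 := le_of_mul_le_mul_left h1 hsq
      change obj k ω (θ₀ + (s k)⁻¹ • x) ≤ obj k ω θ
      linarith
    obtain ⟨hmem, hminθ⟩ := hminω hne
    refine absurd (hall (s k • (θhat k ω - θ₀)) ?_ fun y hy => ?_) (not_lt.2 hω')
    · change θ₀ + (s k)⁻¹ • (s k • (θhat k ω - θ₀)) ∈ Θ
      rwa [hback]
    · change G (s k • (θhat k ω - θ₀)) ≤ G y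
      simp only [hGdef, hback]
      have h1 : obj k ω (θhat k ω) ≤ obj k ω (θ₀ + (s k)⁻¹ • y) := hminθ hy
      gcongr
  calc _ ≤ _ := hincl
    _ ≤ P {ω | K < ‖W k ω‖} + ∑ h ∈ F, P {ω | δ ≤ |s k ^ 2 *
      (obj k ω (θ₀ + (s k)⁻¹ • h) - obj k ω θ₀) - inner ℝ h (-A (W k ω))
        - inner ℝ h (A h) / 2|} :=
      (measure_union_le _ _).trans (add_le_add le_rfl (measure_biUnion_finset_le _ _))
    _ ≤ η / 2 + η / 2 := add_le_add (hK k) hkP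
    _ = η := ENNReal.add_halves η

end ConvexEstimation

/-! ### Local expansion of the PPI objective. -/

namespace PPI

section Algebra

variable {S Ω : Type*} [MeasurableSpace S] {Q : Measure S} {ξ : ℕ → Ω → S} {n N : ℕ}

theorem inner_twoSampleSum {E : Type*} [NormedAddCommGroup E] [InnerProductSpace ℝ E]
    [CompleteSpace E] {a b : S → E} (ha : Integrable a Q) (hb : Integrable b Q) (c : E) (ω : Ω) :
    inner ℝ c (twoSampleSum Q ξ n N a b ω)
      = twoSampleSum Q ξ n N (fun s => inner ℝ c (a s)) (fun s => inner ℝ c (b s)) ω := by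
  simp only [twoSampleSum, inner_smul_right, inner_add_right, inner_sum, inner_sub_right,
    integral_inner ha, integral_inner hb, smul_eq_mul]

theorem twoSampleSum_sub {a b a' b' : S → ℝ} (ha : Integrable a Q) (hb : Integrable b Q)
    (ha' : Integrable a' Q) (hb' : Integrable b' Q) (ω : Ω) :
    twoSampleSum Q ξ n N (fun s => a s - a' s) (fun s => b s - b' s) ω
      = twoSampleSum Q ξ n N a b ω - twoSampleSum Q ξ n N a' b' ω := by
  simp only [twoSampleSum, integral_sub ha ha', integral_sub hb hb', smul_eq_mul,
    Finset.sum_sub_distrib]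
  ring

end Algebra

section Expansion

variable {d : ℕ} {𝒳 𝒲 𝒴 𝒵 Ω : Type*}
  [MeasurableSpace 𝒳] [MeasurableSpace 𝒲] [MeasurableSpace 𝒴] [MeasurableSpace 𝒵]
  {mΩ : MeasurableSpace Ω}
  {Q : Measure (𝒳 × 𝒲 × 𝒴)} [IsProbabilityMeasure Q] {f : 𝒳 → 𝒲 → 𝒵}
  {Θ : Set (EuclideanSpace ℝ (Fin d))}
  {ℓ : EuclideanSpace ℝ (Fin d) → 𝒳 × 𝒴 → ℝ} {g : EuclideanSpace ℝ (Fin d) → 𝒳 × 𝒵 → ℝ}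
  {θ : EuclideanSpace ℝ (Fin d)} {r : ℝ}
  {X : ℕ → Ω → 𝒳} {W : ℕ → Ω → 𝒲} {Y : ℕ → Ω → 𝒴}

/-- The leading term `√n ∇L_g(θ)` of the expansion of the PPI objective, centered. -/
noncomputable def scoreSum (ℓ : EuclideanSpace ℝ (Fin d) → 𝒳 × 𝒴 → ℝ)
    (g : EuclideanSpace ℝ (Fin d) → 𝒳 × 𝒵 → ℝ) (f : 𝒳 → 𝒲 → 𝒵) (Q : Measure (𝒳 × 𝒲 × 𝒴))
    (X : ℕ → Ω → 𝒳) (W : ℕ → Ω → 𝒲) (Y : ℕ → Ω → 𝒴) (θ : EuclideanSpace ℝ (Fin d)) (n N : ℕ) :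
    Ω → EuclideanSpace ℝ (Fin d) :=
  twoSampleSum Q (fun i ω => (X i ω, W i ω, Y i ω)) n N
    (fun z => lossGradient ℓ θ (toXY z) - lossGradient g θ (toXYhat f z))
    (fun z => lossGradient g θ (toXYhat f z))

/-- The difference between a local increment of the PPI objective and its leading term is a
centered sum of remainders plus an increment of the population loss. -/
theorem ppiObjective_increment (hf : Measurable (fun p : 𝒳 × 𝒲 => f p.1 p.2))
    (hℓ : RegularLoss Θ ℓ θ (Q.map toXY)) (hg : RegularLoss Θ g θ (Q.map (toXYhat f)))
    (hθ : θ ∈ interior Θ) {n N : ℕ} (hn : 0 < n) (hN : 0 < N) {h : EuclideanSpace ℝ (Fin d)}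
    (hh : θ + (Real.sqrt n)⁻¹ • h ∈ Θ) (ω : Ω) :
    (Real.sqrt n) ^ 2 * (ppiObjective ℓ g f n N (fun i => X i ω) (fun i => W i ω) (fun i => Y i ω)
          (θ + (Real.sqrt n)⁻¹ • h)
        - ppiObjective ℓ g f n N (fun i => X i ω) (fun i => W i ω) (fun i => Y i ω) θ)
      - inner ℝ h (scoreSum ℓ g f Q X W Y θ n N ω)
    = twoSampleSum Q (fun i ω => (X i ω, W i ω, Y i ω)) n N
        (fun z => lossRemainder ℓ θ h (Real.sqrt n) (toXY z)
          - lossRemainder g θ h (Real.sqrt n) (toXYhat f z))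
        (fun z => lossRemainder g θ h (Real.sqrt n) (toXYhat f z)) ω
      + (Real.sqrt n) ^ 2 * (populationLoss ℓ (Q.map toXY) (θ + (Real.sqrt n)⁻¹ • h)
        - populationLoss ℓ (Q.map toXY) θ) := by
  have hp := (measurable_toXY (𝒳 := 𝒳) (𝒲 := 𝒲) (𝒴 := 𝒴)).aemeasurable (μ := Q)
  have hq := (measurable_toXYhat (𝒴 := 𝒴) hf).aemeasurable (μ := Q)
  have hθΘ := interior_subset hθ
  set s := Real.sqrt n with hs
  set θ' := θ + s⁻¹ • h with hθ'
  have hu : Integrable (fun z => lossGradient ℓ θ (toXY z)) Q :=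
    ((hℓ.memLp_lossGradient hθ).comp_of_map hp).integrable (by norm_num)
  have hv : Integrable (fun z => lossGradient g θ (toXYhat f z)) Q :=
    ((hg.memLp_lossGradient hθ).comp_of_map hq).integrable (by norm_num)
  have hℓi {t : EuclideanSpace ℝ (Fin d)} (ht : t ∈ Θ) :
      Integrable (fun z => ℓ t (toXY z)) Q := (hℓ.integrable t ht).comp_aemeasurable hp
  have hgi {t : EuclideanSpace ℝ (Fin d)} (ht : t ∈ Θ) :
      Integrable (fun z => g t (toXYhat f z)) Q := (hg.integrable t ht).comp_aemeasurable hq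
  have hF {t : EuclideanSpace ℝ (Fin d)} (ht : t ∈ Θ) :
      populationLoss ℓ (Q.map toXY) t = ∫ z, ℓ t (toXY z) ∂Q :=
    integral_map hp (hℓ.integrable t ht).aestronglyMeasurable
  have hLd : Integrable (fun z => ℓ θ' (toXY z) - ℓ θ (toXY z)) Q := (hℓi hh).sub (hℓi hθΘ)
  have hGd : Integrable (fun z => g θ' (toXYhat f z) - g θ (toXYhat f z)) Q :=
    (hgi hh).sub (hgi hθΘ)
  have hai : Integrable (fun z => s * ((ℓ θ' (toXY z) - ℓ θ (toXY z))
      - (g θ' (toXYhat f z) - g θ (toXYhat f z)))) Q := (hLd.sub hGd).const_mul s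
  have hbi : Integrable (fun z => s * (g θ' (toXYhat f z) - g θ (toXYhat f z))) Q :=
    hGd.const_mul s
  have huv : Integrable (fun z => lossGradient ℓ θ (toXY z) - lossGradient g θ (toXYhat f z)) Q :=
    hu.sub hv
  have e1 : (fun z : 𝒳 × 𝒲 × 𝒴 => lossRemainder ℓ θ h s (toXY z)
        - lossRemainder g θ h s (toXYhat f z))
      = fun z => s * ((ℓ θ' (toXY z) - ℓ θ (toXY z)) - (g θ' (toXYhat f z) - g θ (toXYhat f z)))
        - inner ℝ h (lossGradient ℓ θ (toXY z) - lossGradient g θ (toXYhat f z)) := by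
    ext z
    simp only [lossRemainder, inner_sub_right, ← hθ']
    ring
  have e2 : (fun z : 𝒳 × 𝒲 × 𝒴 => lossRemainder g θ h s (toXYhat f z))
      = fun z => s * (g θ' (toXYhat f z) - g θ (toXYhat f z))
        - inner ℝ h (lossGradient g θ (toXYhat f z)) := rfl
  rw [e1, e2, twoSampleSum_sub hai hbi (huv.const_inner h) (hv.const_inner h), scoreSum,
    inner_twoSampleSum huv hv, hF hh, hF hθΘ]
  rw [sub_add_eq_add_sub]
  congr 1
  have hn0 : (n : ℝ) ≠ 0 := by positivity
  have hN0 : (N : ℝ) ≠ 0 := by positivity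
  -- The mean increment of `g` enters the labeled and the unlabeled average with opposite signs and
  -- cancels; only that of `ℓ` survives.
  rw [twoSampleSum, integral_const_mul, integral_const_mul, integral_sub hLd hGd,
    integral_sub (hℓi hh) (hℓi hθΘ), integral_sub (hgi hh) (hgi hθΘ)]
  simp only [ppiObjective, Finset.sum_sub_distrib,
    ← Finset.mul_sum, Finset.sum_const, Finset.card_range, Nat.card_Ico, add_tsub_cancel_left,
    nsmul_eq_mul, smul_eq_mul, ← hs, toXY, toXYhat]
  field_simp
  ring

end Expansion

end PPI

theorem Matrix.IsHermitian.transpose_eq_self {d : ℕ} {H : Matrix (Fin d) (Fin d) ℝ}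
    (hH : H.IsHermitian) : Hᵀ = H := by
  rw [← Matrix.conjTranspose_eq_transpose_of_trivial, hH.eq]

theorem Matrix.IsHermitian.inner_toEuclideanCLM_left {d : ℕ} {H : Matrix (Fin d) (Fin d) ℝ}
    (hH : H.IsHermitian) (x y : EuclideanSpace ℝ (Fin d)) :
    inner ℝ (Matrix.toEuclideanCLM (𝕜 := ℝ) H x) y
      = inner ℝ x (Matrix.toEuclideanCLM (𝕜 := ℝ) H y) := by
  rw [real_inner_comm, Matrix.inner_toEuclideanCLM, Matrix.inner_toEuclideanCLM,
    Matrix.dotProduct_mulVec, dotProduct_comm, ← Matrix.mulVec_transpose, hH.transpose_eq_self]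

/-! ### Convergence of the expansion and of the score. -/

namespace PPI

section Limits

variable {d : ℕ} {𝒳 𝒲 𝒴 𝒵 Ω : Type*}
  [MeasurableSpace 𝒳] [MeasurableSpace 𝒲] [MeasurableSpace 𝒴] [MeasurableSpace 𝒵]
  [MeasurableSpace Ω]
  {Q : Measure (𝒳 × 𝒲 × 𝒴)} [IsProbabilityMeasure Q] {f : 𝒳 → 𝒲 → 𝒵}
  {Θ : Set (EuclideanSpace ℝ (Fin d))}
  {ℓ : EuclideanSpace ℝ (Fin d) → 𝒳 × 𝒴 → ℝ} {g : EuclideanSpace ℝ (Fin d) → 𝒳 × 𝒵 → ℝ}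
  {θ : EuclideanSpace ℝ (Fin d)} {r : ℝ} {P : Measure Ω} [IsProbabilityMeasure P]
  {X : ℕ → Ω → 𝒳} {W : ℕ → Ω → 𝒲} {Y : ℕ → Ω → 𝒴} {n N : ℕ → ℕ}

theorem variance_comp_sub_le {S : Type*} [MeasurableSpace S] {Q : Measure S}
    [IsProbabilityMeasure Q] {a b : S → ℝ} (ha : MemLp a 2 Q) (hb : MemLp b 2 Q) :
    variance (fun s => a s - b s) Q ≤ 2 * (∫ s, a s ^ 2 ∂Q) + 2 * ∫ s, b s ^ 2 ∂Q := by
  refine (variance_le_expectation_sq (ha.sub hb).aestronglyMeasurable).trans ?_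
  rw [← integral_const_mul, ← integral_const_mul, ← integral_add (ha.integrable_sq.const_mul 2)
    (hb.integrable_sq.const_mul 2)]
  refine integral_mono (ha.sub hb).integrable_sq
    ((ha.integrable_sq.const_mul 2).add (hb.integrable_sq.const_mul 2)) fun s => ?_
  simp only [Pi.pow_apply, Pi.sub_apply]
  nlinarith [sq_nonneg (a s + b s)]

/-- Half of `δ` is spent on the Taylor error of the population loss, which is deterministic, and
half on the centered remainders, through Chebyshev. -/
theorem tendsto_measure_ppiObjective_increment_sub_ge
    (hf : Measurable (fun p : 𝒳 × 𝒲 => f p.1 p.2))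
    (hℓ : RegularLoss Θ ℓ θ (Q.map toXY)) (hg : RegularLoss Θ g θ (Q.map (toXYhat f)))
    (hθ : θ ∈ interior Θ) (hcrit : fderiv ℝ (populationLoss ℓ (Q.map toXY)) θ = 0)
    (hindep : iIndepFun (fun i ω => (X i ω, W i ω, Y i ω)) P)
    (hlaw : ∀ i, HasLaw (fun ω => (X i ω, W i ω, Y i ω)) Q P)
    (hn_pos : ∀ k, 0 < n k) (hN_pos : ∀ k, 0 < N k) (hn : Tendsto n atTop atTop)
    (hr : Tendsto (fun k => (n k : ℝ) / (N k : ℝ)) atTop (𝓝 r))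
    (h : EuclideanSpace ℝ (Fin d)) {δ : ℝ} (hδ : 0 < δ) :
    Tendsto (fun k => P {ω | δ ≤ |(Real.sqrt (n k)) ^ 2 *
        (ppiObjective ℓ g f (n k) (N k) (fun i => X i ω) (fun i => W i ω) (fun i => Y i ω)
          (θ + (Real.sqrt (n k))⁻¹ • h)
        - ppiObjective ℓ g f (n k) (N k) (fun i => X i ω) (fun i => W i ω) (fun i => Y i ω) θ)
      - inner ℝ h (scoreSum ℓ g f Q X W Y θ (n k) (N k) ω)
      - inner ℝ h (Matrix.toEuclideanCLM (𝕜 := ℝ) (lossHessian ℓ Q θ) h) / 2|}) atTop (𝓝 0) := by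
  have hp := (measurable_toXY (𝒳 := 𝒳) (𝒲 := 𝒲) (𝒴 := 𝒴)).aemeasurable (μ := Q)
  have hq := (measurable_toXYhat (𝒴 := 𝒴) hf).aemeasurable (μ := Q)
  have hs : Tendsto (fun k => Real.sqrt (n k)) atTop atTop :=
    Real.tendsto_sqrt_atTop.comp (tendsto_natCast_atTop_atTop.comp hn)
  set a : ℕ → 𝒳 × 𝒲 × 𝒴 → ℝ := fun k z => lossRemainder ℓ θ h (Real.sqrt (n k)) (toXY z) with ha
  set b : ℕ → 𝒳 × 𝒲 × 𝒴 → ℝ := fun k z => lossRemainder g θ h (Real.sqrt (n k)) (toXYhat f z)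
    with hb
  have haL : ∀ᶠ k in atTop, MemLp (a k) 2 Q := by
    filter_upwards [hs.eventually (hℓ.eventually_memLp_lossRemainder hθ h)] with k hk
    exact hk.comp_of_map hp
  have hbL : ∀ᶠ k in atTop, MemLp (b k) 2 Q := by
    filter_upwards [hs.eventually (hg.eventually_memLp_lossRemainder hθ h)] with k hk
    exact hk.comp_of_map hq
  have ha0 : Tendsto (fun k => ∫ z, a k z ^ 2 ∂Q) atTop (𝓝 0) := by
    refine ((hℓ.tendsto_integral_lossRemainder_sq hθ h).comp hs).congr' ?_
    filter_upwards [hs.eventually (hℓ.eventually_memLp_lossRemainder hθ h)] with k hk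
    exact integral_map hp (hk.aestronglyMeasurable.pow 2)
  have hb0 : Tendsto (fun k => ∫ z, b k z ^ 2 ∂Q) atTop (𝓝 0) := by
    refine ((hg.tendsto_integral_lossRemainder_sq hθ h).comp hs).congr' ?_
    filter_upwards [hs.eventually (hg.eventually_memLp_lossRemainder hθ h)] with k hk
    exact integral_map hq (hk.aestronglyMeasurable.pow 2)
  have hpop := hℓ.twice_differentiable.tendsto_taylor hcrit h hs
  rw [fderiv_fderiv_eq_dotProduct, ← Matrix.inner_toEuclideanCLM] at hpop
  have hmem : ∀ᶠ k in atTop, θ + (Real.sqrt (n k))⁻¹ • h ∈ Θ :=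
    hs.eventually ((tendsto_add_inv_smul θ h).eventually (mem_interior_iff_mem_nhds.1 hθ))
  have hbound : Tendsto (fun k => ENNReal.ofReal
      ((2 * (∫ z, a k z ^ 2 ∂Q) + 2 * (∫ z, b k z ^ 2 ∂Q)
        + (n k : ℝ) / N k * ∫ z, b k z ^ 2 ∂Q) / (δ / 2) ^ 2)) atTop (𝓝 0) := by
    have h1 := (((ha0.const_mul 2).add (hb0.const_mul 2)).add (hr.mul hb0)).div_const ((δ / 2) ^ 2)
    simpa using ENNReal.tendsto_ofReal h1
  refine tendsto_of_tendsto_of_tendsto_of_le_of_le' tendsto_const_nhds hbound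
    (Eventually.of_forall fun _ => zero_le) ?_
  filter_upwards [haL, hbL, hmem, Metric.tendsto_nhds.1 hpop (δ / 2) (by positivity)]
    with k hak hbk hk hpopk
  refine le_trans (measure_mono ?_) ((measure_twoSampleSum_ge_le (n := n k) (N := N k) hlaw hindep
    (hak.sub hbk) hbk (hn_pos k) (hN_pos k) (by positivity : 0 < δ / 2)).trans
    (ENNReal.ofReal_le_ofReal ?_))
  · intro ω hω
    have hω' := Set.mem_ofPred_eq ▸ hω
    rw [ppiObjective_increment hf hℓ hg hθ (hn_pos k) (hN_pos k) hk ω] at hω'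
    rw [Real.dist_eq] at hpopk
    change δ / 2 ≤ |twoSampleSum Q (fun i ω => (X i ω, W i ω, Y i ω)) (n k) (N k)
      (fun z => a k z - b k z) (b k) ω|
    set T := twoSampleSum Q (fun i ω => (X i ω, W i ω, Y i ω)) (n k) (N k)
      (fun z => a k z - b k z) (b k) ω with hT
    rw [add_sub_assoc] at hω'
    have h1 := hω'.trans (abs_add_le _ _)
    have h2 : |(Real.sqrt (n k)) ^ 2 * (populationLoss ℓ (Q.map toXY)
          (θ + (Real.sqrt (n k))⁻¹ • h) - populationLoss ℓ (Q.map toXY) θ)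
        - inner ℝ h (Matrix.toEuclideanCLM (𝕜 := ℝ) (lossHessian ℓ Q θ) h) / 2| < δ / 2 := hpopk
    linarith
  · have h1 := variance_comp_sub_le hak hbk
    have h2 : variance (b k) Q ≤ ∫ z, b k z ^ 2 ∂Q :=
      variance_le_expectation_sq hbk.aestronglyMeasurable
    have h3 : variance (a k - b k) Q = variance (fun s => a k s - b k s) Q := rfl
    gcongr
    rw [h3]
    exact h1

theorem tendsto_charFun_scoreSum (hf : Measurable (fun p : 𝒳 × 𝒲 => f p.1 p.2))
    (hℓ : HasSquareIntegrableGradient ℓ θ (Q.map toXY)) (hH : (lossHessian ℓ Q θ).IsHermitian)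
    (hg : HasSquareIntegrableGradient g θ (Q.map (toXYhat f)))
    (hindep : iIndepFun (fun i ω => (X i ω, W i ω, Y i ω)) P)
    (hlaw : ∀ i, HasLaw (fun ω => (X i ω, W i ω, Y i ω)) Q P)
    (hn_pos : ∀ k, 0 < n k) (hN_pos : ∀ k, 0 < N k) (hn : Tendsto n atTop atTop)
    (hr : Tendsto (fun k => (n k : ℝ) / (N k : ℝ)) atTop (𝓝 r)) (hr0 : 0 ≤ r)
    (t : EuclideanSpace ℝ (Fin d)) :
    Tendsto (fun k => charFun (P.map fun ω => -Matrix.toEuclideanCLM (𝕜 := ℝ)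
      (lossHessian ℓ Q θ)⁻¹ (scoreSum ℓ g f Q X W Y θ (n k) (N k) ω)) t) atTop
      (𝓝 (charFun (multivariateGaussian 0 (asymCov ℓ g f Q r θ)) t)) := by
  have hℓ2 := hℓ.2.comp_of_map (measurable_toXY (𝒲 := 𝒲)).aemeasurable
  have hg2 : MemLp (fun z => lossGradient g θ (toXYhat f z)) 2 Q :=
    hg.2.comp_of_map (measurable_toXYhat (𝒴 := 𝒴) hf).aemeasurable
  have huv : MemLp (fun z => lossGradient ℓ θ (toXY z) - lossGradient g θ (toXYhat f z)) 2 Q :=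
    hℓ2.sub hg2
  set B := Matrix.toEuclideanCLM (𝕜 := ℝ) (lossHessian ℓ Q θ)⁻¹ with hB
  -- Cramér–Wold: as `B` is symmetric, pairing `-B S` with `t` is pairing `S` with `c`, a scalar
  -- two-sample sum.
  set c : EuclideanSpace ℝ (Fin d) := -B t with hc
  have hmeas (k : ℕ) : AEMeasurable (scoreSum ℓ g f Q X W Y θ (n k) (N k)) P :=
    aemeasurable_twoSampleSum hlaw huv.aestronglyMeasurable.aemeasurable
      hg2.aestronglyMeasurable.aemeasurable
  have hinner (k : ℕ) (ω : Ω) : inner ℝ (-B (scoreSum ℓ g f Q X W Y θ (n k) (N k) ω)) t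
      = twoSampleSum Q (fun i ω => (X i ω, W i ω, Y i ω)) (n k) (N k)
        (fun z => inner ℝ c (lossGradient ℓ θ (toXY z) - lossGradient g θ (toXYhat f z)))
        (fun z => inner ℝ c (lossGradient g θ (toXYhat f z))) ω := by
    rw [← inner_twoSampleSum (huv.integrable (by norm_num)) (hg2.integrable (by norm_num)), hc,
      inner_neg_left, inner_neg_left, hH.inv.inner_toEuclideanCLM_left, hB,
      hH.inv.inner_toEuclideanCLM_left, real_inner_comm, hH.inv.inner_toEuclideanCLM_left]
    rfl
  have hchar (k : ℕ) : charFun (P.map fun ω => -B (scoreSum ℓ g f Q X W Y θ (n k) (N k) ω)) t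
      = charFun (P.map (twoSampleSum Q (fun i ω => (X i ω, W i ω, Y i ω)) (n k) (N k)
        (fun z => inner ℝ c (lossGradient ℓ θ (toXY z) - lossGradient g θ (toXYhat f z)))
        (fun z => inner ℝ c (lossGradient g θ (toXYhat f z))))) 1 := by
    have hBm : AEMeasurable (fun ω => -B (scoreSum ℓ g f Q X W Y θ (n k) (N k) ω)) P :=
      (B.continuous.measurable.comp_aemeasurable (hmeas k)).neg
    rw [charFun_apply, charFun_apply_real, integral_map hBm (by fun_prop),
      integral_map (aemeasurable_twoSampleSum hlaw
        (huv.const_inner c).aestronglyMeasurable.aemeasurable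
        (hg2.const_inner c).aestronglyMeasurable.aemeasurable) (by fun_prop)]
    refine integral_congr_ae (Eventually.of_forall fun ω => ?_)
    simp only [hinner, Complex.ofReal_one, one_mul]
  simp_rw [hchar]
  rw [charFun_multivariateGaussian (posSemidef_asymCov hf hℓ hH hg hr0)]
  convert! tendsto_charFun_twoSampleSum hlaw hindep (huv.const_inner c) (hg2.const_inner c)
    hn_pos hN_pos hn hr using 2
  rw [← dotProduct_covMatrix_mulVec huv, ← dotProduct_covMatrix_mulVec hg2]
  congr 1
  have hquad : t.ofLp ⬝ᵥ (asymCov ℓ g f Q r θ *ᵥ t.ofLp)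
      = c.ofLp ⬝ᵥ ((r • covMatrix (fun z => lossGradient g θ (toXYhat f z)) Q
      + covMatrix (fun z => lossGradient ℓ θ (toXY z) - lossGradient g θ (toXYhat f z)) Q)
        *ᵥ c.ofLp) := by
    have hcc : c.ofLp = -((lossHessian ℓ Q θ)⁻¹ *ᵥ t.ofLp) := by
      rw [hc, WithLp.ofLp_neg, hB, Matrix.ofLp_toEuclideanCLM]
    rw [asymCov, hcc, ← Matrix.mulVec_mulVec, ← Matrix.mulVec_mulVec, Matrix.dotProduct_mulVec,
      ← Matrix.mulVec_transpose, hH.inv.transpose_eq_self, Matrix.mulVec_neg, dotProduct_neg, neg_dotProduct, neg_neg]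
  rw [hquad, Matrix.add_mulVec, Matrix.smul_mulVec, dotProduct_add, dotProduct_smul]
  simp only [inner_zero_right, Complex.ofReal_zero, zero_mul, zero_sub, smul_eq_mul]
  push_cast
  rw [add_comm (_ : ℂ)]

end Limits

end PPI

theorem MeasureTheory.IsTightMeasureSet.exists_forall_measure_lt_norm_le {Ω E : Type*}
    [MeasurableSpace Ω] [NormedAddCommGroup E] [MeasurableSpace E] [BorelSpace E] {P : Measure Ω}
    {W : ℕ → Ω → E} (hW : ∀ k, AEMeasurable (W k) P)
    (h : IsTightMeasureSet (Set.range fun k => P.map (W k))) (η : ℝ≥0∞) (hη : 0 < η) :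
    ∃ K : ℝ, ∀ k, P {ω | K < ‖W k ω‖} ≤ η := by
  obtain ⟨K, hK, hKη⟩ := isTightMeasureSet_iff_exists_isCompact_measure_compl_le.1 h η hη
  obtain ⟨R, hR⟩ := hK.isBounded.subset_closedBall 0
  refine ⟨R, fun k => ?_⟩
  have h1 : MeasurableSet {x : E | R < ‖x‖} := measurableSet_lt measurable_const measurable_norm
  have h2 : P {ω | R < ‖W k ω‖} = P.map (W k) {x | R < ‖x‖} :=
    (Measure.map_apply_of_aemeasurable (hW k) h1).symm
  rw [h2]
  refine (measure_mono fun x hx hxK => ?_).trans (hKη _ ⟨k, rfl⟩)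
  have := hR hxK
  rw [mem_closedBall_zero_iff] at this
  exact absurd hx (not_lt.2 this)

/-! ### Asymptotic normality and the main theorem. -/

namespace PPI

section AsymptoticNormality

variable {d : ℕ} {𝒳 𝒲 𝒴 𝒵 Ω : Type*}
  [MeasurableSpace 𝒳] [MeasurableSpace 𝒲] [MeasurableSpace 𝒴] [MeasurableSpace 𝒵]
  [MeasurableSpace Ω]
  {Q : Measure (𝒳 × 𝒲 × 𝒴)} [IsProbabilityMeasure Q] {f : 𝒳 → 𝒲 → 𝒵}
  {Θ : Set (EuclideanSpace ℝ (Fin d))}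
  {ℓ : EuclideanSpace ℝ (Fin d) → 𝒳 × 𝒴 → ℝ} {g : EuclideanSpace ℝ (Fin d) → 𝒳 × 𝒵 → ℝ}
  {θ : EuclideanSpace ℝ (Fin d)} {r : ℝ} {P : Measure Ω} [IsProbabilityMeasure P]
  {X : ℕ → Ω → 𝒳} {W : ℕ → Ω → 𝒲} {Y : ℕ → Ω → 𝒴} {n N : ℕ → ℕ}

/-- Slutsky: the rescaled estimator differs by `o_P(1)` from `Z = -H⁻¹ S`, the minimizer of the
limiting quadratic, and `Z` has the Gaussian limit. -/
theorem tendstoInDistribution_ppi (hf : Measurable (fun p : 𝒳 × 𝒲 => f p.1 p.2))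
    (hℓ : RegularLoss Θ ℓ θ (Q.map toXY)) (hg : RegularLoss Θ g θ (Q.map (toXYhat f)))
    (hθ : θ ∈ interior Θ) (hcrit : fderiv ℝ (populationLoss ℓ (Q.map toXY)) θ = 0)
    (hindep : iIndepFun (fun i ω => (X i ω, W i ω, Y i ω)) P)
    (hlaw : ∀ i, HasLaw (fun ω => (X i ω, W i ω, Y i ω)) Q P)
    (hn_pos : ∀ k, 0 < n k) (hN_pos : ∀ k, 0 < N k) (hn : Tendsto n atTop atTop)
    (hr : Tendsto (fun k => (n k : ℝ) / (N k : ℝ)) atTop (𝓝 r)) (hr0 : 0 ≤ r)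
    (hconv : ∀ k, ∀ᵐ ω ∂P, ConvexOn ℝ Θ (ppiObjective ℓ g f (n k) (N k) (fun i => X i ω)
      (fun i => W i ω) (fun i => Y i ω)))
    {θhat : ℕ → Ω → EuclideanSpace ℝ (Fin d)} (hθhat : ∀ k, AEMeasurable (θhat k) P)
    (hmin : ∀ k, ∀ᵐ ω ∂P, (argminOn Θ (ppiObjective ℓ g f (n k) (N k) (fun i => X i ω)
        (fun i => W i ω) (fun i => Y i ω))).Nonempty →
      θhat k ω ∈ argminOn Θ (ppiObjective ℓ g f (n k) (N k) (fun i => X i ω)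
        (fun i => W i ω) (fun i => Y i ω))) :
    TendstoInDistribution (fun k ω => Real.sqrt (n k) • (θhat k ω - θ)) atTop id
      (fun _ => P) (multivariateGaussian 0 (asymCov ℓ g f Q r θ)) := by
  have hH : (lossHessian ℓ Q θ).PosDef := hℓ.hessian_posDef
  have hℓS := hℓ.hasSquareIntegrableGradient hθ
  have hgS := hg.hasSquareIntegrableGradient hθ
  set A := Matrix.toEuclideanCLM (𝕜 := ℝ) (lossHessian ℓ Q θ) with hA
  set B := Matrix.toEuclideanCLM (𝕜 := ℝ) (lossHessian ℓ Q θ)⁻¹ with hB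
  have hAB (z : EuclideanSpace ℝ (Fin d)) : A (B z) = z := by
    have h1 : A * B = 1 := by
      rw [hA, hB, ← map_mul, Matrix.mul_nonsing_inv _ (isUnit_iff_ne_zero.2 hH.det_pos.ne'),
        map_one]
    exact congrArg (fun T : EuclideanSpace ℝ (Fin d) →L[ℝ] EuclideanSpace ℝ (Fin d) => T z) h1
  set Z : ℕ → Ω → EuclideanSpace ℝ (Fin d) :=
    fun k ω => -B (scoreSum ℓ g f Q X W Y θ (n k) (N k) ω) with hZ
  have hAZ (k : ℕ) (ω : Ω) : -A (Z k ω) = scoreSum ℓ g f Q X W Y θ (n k) (N k) ω := by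
    rw [hZ, map_neg, neg_neg, hAB]
  have hZm (k : ℕ) : AEMeasurable (Z k) P := by
    have hℓ2 := (hℓS.2.comp_of_map (measurable_toXY (𝒲 := 𝒲)).aemeasurable)
    have hg2 := (hgS.2.comp_of_map (measurable_toXYhat (𝒴 := 𝒴) hf).aemeasurable)
    have h1 : AEMeasurable (scoreSum ℓ g f Q X W Y θ (n k) (N k)) P :=
      aemeasurable_twoSampleSum hlaw (hℓ2.sub hg2).aestronglyMeasurable.aemeasurable
        hg2.aestronglyMeasurable.aemeasurable
    exact (B.continuous.measurable.comp_aemeasurable h1).neg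
  have hZprob (k : ℕ) : IsProbabilityMeasure (P.map (Z k)) :=
    Measure.isProbabilityMeasure_map (hZm k)
  have hchar := tendsto_charFun_scoreSum hf hℓS hH.isHermitian hgS hindep hlaw hn_pos hN_pos hn hr
    hr0
  have hZlim : TendstoInDistribution Z atTop id (fun _ => P)
      (multivariateGaussian 0 (asymCov ℓ g f Q r θ)) :=
    { forall_aemeasurable := hZm
      aemeasurable_limit := aemeasurable_id
      tendsto := by
        refine ProbabilityMeasure.tendsto_of_tendsto_charFun fun t => ?_
        simpa only [ProbabilityMeasure.coe_mk, Measure.map_id] using hchar t }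
  -- Convergence of characteristic functions to one continuous at `0` gives tightness, which
  -- confines the random minimizers to a fixed ball.
  have htight : IsTightMeasureSet (Set.range fun k => P.map (Z k)) :=
    isTightMeasureSet_of_tendsto_charFun (continuous_charFun.continuousAt) hchar
  have hs_pos (k : ℕ) : 0 < Real.sqrt (n k) := Real.sqrt_pos.2 (by exact_mod_cast hn_pos k)
  have hs : Tendsto (fun k => Real.sqrt (n k)) atTop atTop :=
    Real.tendsto_sqrt_atTop.comp (tendsto_natCast_atTop_atTop.comp hn)
  have hdiff := tendstoInMeasure_argmin_of_convexOn hθ hconv hs_pos hs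
    hH.isHermitian.inner_toEuclideanCLM_left (fun x hx => by
      rw [Matrix.inner_toEuclideanCLM]
      have hx' : x.ofLp ≠ 0 := fun h0 => hx (by ext i; simp [h0])
      simpa using hH.dotProduct_mulVec_pos hx')
    (htight.exists_forall_measure_lt_norm_le hZm)
    (fun h δ hδ => by
      simp only [← hA, hAZ]
      exact tendsto_measure_ppiObjective_increment_sub_ge hf hℓ hg hθ hcrit hindep hlaw hn_pos
        hN_pos hn hr h hδ) hmin
  refine tendstoInDistribution_of_tendstoInMeasure_sub _ _ hZlim hdiff fun k => ?_
  exact (measurable_const_smul (Real.sqrt (n k))).comp_aemeasurable ((hθhat k).sub_const θ)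

end AsymptoticNormality

end PPI

theorem theorem1 {d : ℕ} {𝒳 𝒲 𝒴 𝒵 Ω : Type*}
    [MeasurableSpace 𝒳] [MeasurableSpace 𝒲] [MeasurableSpace 𝒴] [MeasurableSpace 𝒵]
    [MeasurableSpace Ω]
    -- the law `Q` of `(X, W, Y)`, and the prediction model `f`, `Ŷ = f X W`
    (Q : Measure (𝒳 × 𝒲 × 𝒴)) [IsProbabilityMeasure Q]
    (f : 𝒳 → 𝒲 → 𝒵) (hf : Measurable (fun p : 𝒳 × 𝒲 => f p.1 p.2))
    -- the loss, and its unique target over the parameter space `Θ`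
    (Θ : Set (EuclideanSpace ℝ (Fin d)))
    (ℓ : EuclideanSpace ℝ (Fin d) → 𝒳 × 𝒴 → ℝ)
    (θstar : EuclideanSpace ℝ (Fin d)) (hθ_int : θstar ∈ interior Θ)
    (hℓ : PPI.RegularLoss Θ ℓ θstar (Q.map PPI.toXY))
    (htarget : PPI.argminOn Θ (PPI.populationLoss ℓ (Q.map PPI.toXY)) = {θstar})
    -- i.i.d. observations with law `Q`
    (P : Measure Ω) [IsProbabilityMeasure P]
    (X : ℕ → Ω → 𝒳) (W : ℕ → Ω → 𝒲) (Y : ℕ → Ω → 𝒴)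
    (hindep : iIndepFun (fun i ω => (X i ω, W i ω, Y i ω)) P)
    (hlaw : ∀ i, HasLaw (fun ω => (X i ω, W i ω, Y i ω)) Q P)
    -- at stage `k` there are `n k` labeled and `N k` unlabeled observations, and `n / N → r`
    (n N : ℕ → ℕ) (hn_pos : ∀ k, 0 < n k) (hN_pos : ∀ k, 0 < N k)
    (hn : Tendsto n atTop atTop)
    (r : ℝ) (hr : Tendsto (fun k => (n k : ℝ) / (N k : ℝ)) atTop (𝓝 r)) :
    -- asymptotic normality of the PPI estimator, for every regular imputed loss `g`
    (∀ g : EuclideanSpace ℝ (Fin d) → 𝒳 × 𝒵 → ℝ,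
      PPI.RegularLoss Θ g θstar (Q.map (PPI.toXYhat f)) →
      (∀ k, ∀ᵐ ω ∂P, ConvexOn ℝ Θ
        (PPI.ppiObjective ℓ g f (n k) (N k) (fun i => X i ω) (fun i => W i ω)
          (fun i => Y i ω))) →
      ∀ θhat : ℕ → Ω → EuclideanSpace ℝ (Fin d),
        (∀ k, AEMeasurable (θhat k) P) →
        -- `θhat k` is a minimizer of the objective whenever there is one
        (∀ k, ∀ᵐ ω ∂P,
          (PPI.argminOn Θ (PPI.ppiObjective ℓ g f (n k) (N k) (fun i => X i ω)
            (fun i => W i ω) (fun i => Y i ω))).Nonempty →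
          θhat k ω ∈ PPI.argminOn Θ (PPI.ppiObjective ℓ g f (n k) (N k) (fun i => X i ω)
            (fun i => W i ω) (fun i => Y i ω))) →
        (PPI.asymCov ℓ g f Q r θstar).PosSemidef ∧
        TendstoInDistribution (fun k ω => Real.sqrt (n k) • (θhat k ω - θstar)) atTop id
          (fun _ => P) (multivariateGaussian 0 (PPI.asymCov ℓ g f Q r θstar))) ∧
    -- the optimal imputed loss
    (∀ g : EuclideanSpace ℝ (Fin d) → 𝒳 × 𝒵 → ℝ,
      PPI.HasSquareIntegrableGradient g θstar (Q.map (PPI.toXYhat f)) →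
      (∀ᵐ z ∂Q, PPI.lossGradient g θstar (PPI.toXYhat f z)
        = (1 / (1 + r)) • PPI.condGradient ℓ f Q θstar z) →
      PPI.asymCov ℓ g f Q r θstar
        = (PPI.lossHessian ℓ Q θstar)⁻¹ *
            (PPI.covMatrix (fun z => PPI.lossGradient ℓ θstar (PPI.toXY z)) Q
              - (1 / (1 + r)) • PPI.covMatrix (PPI.condGradient ℓ f Q θstar) Q) *
            (PPI.lossHessian ℓ Q θstar)⁻¹ ∧
      ∀ g' : EuclideanSpace ℝ (Fin d) → 𝒳 × 𝒵 → ℝ,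
        PPI.HasSquareIntegrableGradient g' θstar (Q.map (PPI.toXYhat f)) →
        (PPI.asymCov ℓ g' f Q r θstar - PPI.asymCov ℓ g f Q r θstar).PosSemidef) := by
  have hr0 : 0 ≤ r := ge_of_tendsto' hr fun k => by positivity
  have hH : (PPI.lossHessian ℓ Q θstar).IsHermitian := hℓ.hessian_posDef.isHermitian
  have hℓS := hℓ.hasSquareIntegrableGradient hθ_int
  have hcrit : fderiv ℝ (PPI.populationLoss ℓ (Q.map PPI.toXY)) θstar = 0 := by
    have hmem : θstar ∈ PPI.argminOn Θ (PPI.populationLoss ℓ (Q.map PPI.toXY)) := by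
      rw [htarget]
      exact Set.mem_singleton _
    exact (hmem.2.isLocalMin (mem_interior_iff_mem_nhds.1 hθ_int)).fderiv_eq_zero
  refine ⟨fun g hg hconv θhat hθhat hmin => ⟨?_, ?_⟩, fun g hg h => ⟨?_, fun g' hg' => ?_⟩⟩
  · exact PPI.posSemidef_asymCov hf hℓS hH (hg.hasSquareIntegrableGradient hθ_int) hr0
  · exact PPI.tendstoInDistribution_ppi hf hℓ hg hθ_int hcrit hindep hlaw hn_pos hN_pos hn hr hr0
      hconv hθhat hmin
  · exact PPI.asymCov_eq_of_gradient_eq hf hℓS hg hr0 h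
  · exact PPI.posSemidef_asymCov_sub hf hℓS hH hg hr0 h hg'
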